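/- **Setting.** Let $\mathcal X=\mathbb R^{d_1\times r}$ with the Frobenius norm and $\mathcal Y=\mathbb R^{d_2}$ with the Euclidean norm. Put $c(x)=x^\top x-I_r$ (whose zero set is the Stiefel manifold) and $A(x)=x(\tfrac32 I_r-\tfrac12x^\top x)$. Fix $C>0$, $\rho>0$, $\zeta\ge 0$, $\mu>0$, and let $X=\{x\in\mathcal X:\|x\|\le C\}$, $\bar X=A(X)$. Let $\partial$ denote the Fréchet subdifferential, let $\delta_X$ be the indicator function of $X$ ($0$ on $X$, $+\infty$ elsewhere), and let $\operatorname{dist}(0,\emptyset)=+\infty$. Assume: 1. $h:\mathcal Y\to\mathbb R\cup\{+\infty\}$ is proper, closed and $\zeta$-weakly convex (i.e. $h+\tfrac\zeta2\|\cdot\|^2$ is convex), its domain $Y=\{y:h(y)<\infty\}$ is closed and bounded, and $h$ is locally Lipschitz on $Y$. 2. $f:\mathcal X\times\mathcal Y\to\mathbb R$ is differentiable on an open set containing $\bar X\times Y$, and for some constants $L_{xx},L_{xy},L_{yx},L_{yy}\ge0$ and all $x_1,x_2\in\bar X$, $y_1,y_2\in Y$, $$\|\nabla_xf(x_1,y_1)-\nabla_xf(x_2,y_2)\|\le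 L_{xx}\|x_1-x_2\|+L_{xy}\|y_1-y_2\|,$$ $$\|\nabla_yf(x_1,y_1)-\nabla_yf(x_2,y_2)\|\le L_{yx}\|x_1-x_2\|+L_{yy}\|y_1-y_2\|.$$ 3. (PL) With $f_r=f-h$ and $F(x)=\max_{w}f_r(x,w)$, one has $F(x)-f_r(x,y)\le\frac1{2\mu}\operatorname{dist}^2\big(0,-\nabla_yf(x,y)+\partial h(y)\big)$ for all $x\in\bar X$, $y\in Y$. Let $\tilde f(x,y)=f(A(x),y)+\frac\rho4\|c(x)\|^2$; the penalized problem is $\min_{x\in X}\max_y \tilde f(x,y)-h(y)$. There is a constant $l>0$ such that, for all $x_1,x_2\in X$ and $y_1,y_2\in Y$, both $\|\nabla_x\tilde f(x_1,y_1)-\nabla_x\tilde f(x_2,y_2)\|$ and $\|\nabla_y\tilde f(x_1,y_1)-\nabla_y\tilde f(x_2,y_2)\|$ are at most $l\|x_1-x_2\|+l\|y_1-y_2\|$; fix any such $l$. Put $p=2l$, $\bar\kappa=\max\{1,l/\mu\}$, $$\hat f(x,y;z)=\tilde f(x,y)+\tfrac p2\|x-z\|^2,\qquad \hat f_r=\hat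 f-h,\qquad \Phi(x;z)=\max_y\hat f_r(x,y;z),$$ $$\Psi_r(y;z)=\min_{x\in X}\hat f(x,y;z)-h(y),\qquad P(z)=\min_{x\in X}\Phi(x;z),\qquad \bar F=\min_{x\in X}F(A(x)).$$ **Algorithm (sm-MGDA).** Let $\tau_1\in(0,\frac1{3l}]$, $\tau_2=\frac1{16}\big(\frac3{\tau_1}+\zeta\big)^{-1}$, $\alpha\in(0,\frac1{2306})$ and $\beta=\alpha\min\{\mu,l\}\tau_2$. From an arbitrary $(x_0,y_0,z_0)\in X\times Y\times\mathcal X$ iterate, for $t\ge0$, $$x_{t+1}=\mathcal P_X\big(x_t-\tau_1(g_t+p(x_t-z_t))\big),\quad y_{t+1}=\operatorname{prox}_{\tau_2h}\big(y_t+\tau_2\nabla_yf(A(x_{t+1}),y_t)\big),\quad z_{t+1}=z_t+\beta(x_{t+1}-z_t),$$ where $g_t=\nabla A(x_t)[\nabla_xf(A(x_t),y_t)]+\frac\rho2\nabla c(x_t)[c(x_t)]$, with $\nabla A(x)[u]=u(\frac32I_r-\frac12x^\top x)-x\,\frac{x^\top u+u^\top x}{2}$ and $\nabla c(x)[u]=2xu$.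 For $t\ge0$ let $$G^x_{t+1}=\tfrac{x_t-x_{t+1}}{\tau_1}+\nabla_x\tilde f(x_{t+1},y_{t+1})-\nabla_x\tilde f(x_t,y_t)+p(z_t-x_t),$$ $$G^y_{t+1}=\tfrac{y_{t+1}-y_t}{\tau_2}+\nabla_y\tilde f(x_{t+1},y_{t+1})-\nabla_y\tilde f(x_{t+1},y_t),$$ and let $\Delta_0=\hat f_r(x_0,y_0;z_0)+P(z_0)-2\Psi_r(y_0;z_0)$. **Theorem.** There is an absolute constant $K>0$ such that, in every such situation, the following hold. * For every $T\ge1$, $$\frac1T\sum_{t=1}^T\Big(\|G^x_t\|^2+\bar\kappa\|G^y_t\|^2\Big)\le \frac{K}{\alpha}\cdot\frac{\bar\kappa}{T}\Big(\frac1{\tau_1}+\zeta\Big)\big(P(z_0)-\bar F+\Delta_0\big).$$ * $G^x_t\in\nabla_x\tilde f(x_t,y_t)+\partial\delta_X(x_t)$ and $G^y_t\in\nabla_y\tilde f(x_t,y_t)-\partial h(y_t)$ for all $t\ge1$. * For every $T\ge1$, with $\varepsilon_T=\sqrt{\frac{K}{\alpha}\cdot\frac{\bar\kappa}{T}\big(\frac1{\tau_1}+\zeta\big)\big(P(z_0)-\bar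 F+\Delta_0\big)}=O\big(\sqrt{\bar\kappa/T}\big)$, $$\min_{1\le t\le T}\max\Big\{\operatorname{dist}\big(0,\nabla_x\tilde f(x_t,y_t)+\partial\delta_X(x_t)\big),\ \sqrt{\bar\kappa}\,\operatorname{dist}\big(0,-\nabla_y\tilde f(x_t,y_t)+\partial h(y_t)\big)\Big\}\le\varepsilon_T .$$ In particular, some $(x_t,y_t)\in X\times Y$ with $1\le t\le T$ is an $\varepsilon_T$-stationary point of the penalized problem, i.e. both distances are at most $\varepsilon_T$. * $0\le\Delta_0\le2\big(\Phi(x_0;z_0)-\Psi_r(y_0;z_0)\big)$. -/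

import Mathlib

noncomputable section

namespace SmMGDA

/-- Real `d₁ × r` matrices with the Frobenius norm and inner product. -/
abbrev XSpace (d₁ r : ℕ) := EuclideanSpace ℝ (Fin d₁ × Fin r)

/-- The dual space `ℝ^{d₂}` with the Euclidean norm. -/
abbrev YSpace (d₂ : ℕ) := EuclideanSpace ℝ (Fin d₂)

section Matrices

variable {d₁ r : ℕ}

/-- A vector of `XSpace d₁ r`, read as a matrix. -/
def toMat (x : XSpace d₁ r) : Matrix (Fin d₁) (Fin r) ℝ := Matrix.of fun i j => x (i, j)

/-- A matrix, read as a vector of `XSpace d₁ r`. -/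
def ofMat (M : Matrix (Fin d₁) (Fin r) ℝ) : XSpace d₁ r := WithLp.toLp 2 fun ij => M ij.1 ij.2

/-- `c(x) = xᵀ x - I`, the defining function of the Stiefel manifold. -/
def stiefelConstraint (x : XSpace d₁ r) : Matrix (Fin r) (Fin r) ℝ :=
  (toMat x).transpose * toMat x - 1

/-- The squared Frobenius norm of a matrix. -/
def frobeniusSq (M : Matrix (Fin r) (Fin r) ℝ) : ℝ := ∑ i, ∑ j, M i j ^ 2

/-- `sym(M) = (M + Mᵀ) / 2`. -/
def symPart (M : Matrix (Fin r) (Fin r) ℝ) : Matrix (Fin r) (Fin r) ℝ :=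
  (1 / 2 : ℝ) • (M + M.transpose)

/-- `(3/2) I - (1/2) xᵀ x`. -/
def dissolveFactor (x : XSpace d₁ r) : Matrix (Fin r) (Fin r) ℝ :=
  (3 / 2 : ℝ) • 1 - (1 / 2 : ℝ) • ((toMat x).transpose * toMat x)

/-- The constraint dissolving operator `A(x) = x ((3/2) I - (1/2) xᵀ x)`. -/
def dissolve (x : XSpace d₁ r) : XSpace d₁ r := ofMat (toMat x * dissolveFactor x)

/-- `∇A(x)[u] = u ((3/2) I - (1/2) xᵀ x) - x sym(xᵀ u)`, the transposed Jacobian of `A` at `x`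
applied to `u`. -/
def dissolveGrad (x u : XSpace d₁ r) : XSpace d₁ r :=
  ofMat (toMat u * dissolveFactor x - toMat x * symPart ((toMat x).transpose * toMat u))

/-- `∇c(x)[u] = 2 x u`, the transposed Jacobian of `c` at `x` applied to a symmetric `u`. -/
def constraintGrad (x : XSpace d₁ r) (u : Matrix (Fin r) (Fin r) ℝ) : XSpace d₁ r :=
  ofMat ((2 : ℝ) • (toMat x * u))

end Matrices

section ConvexAnalysis

variable {E : Type*} [NormedAddCommGroup E] [InnerProductSpace ℝ E]

/-- The effective domain of an extended-real-valued function. -/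
def effDomain (φ : E → EReal) : Set E := {y | φ y < ⊤}

/-- Proper: never `-∞`, and not identically `+∞`. -/
def IsProper (φ : E → EReal) : Prop := (∀ y, ⊥ < φ y) ∧ (effDomain φ).Nonempty

/-- `ζ`-weak convexity of a proper function: `φ + (ζ/2) ‖·‖²` is convex. Since `φ` is `+∞` off its
effective domain, this says that the domain is convex and that the sum is convex on it. -/
def IsWeaklyConvex (ζ : ℝ) (φ : E → EReal) : Prop :=
  ConvexOn ℝ (effDomain φ) fun y => (φ y).toReal + ζ / 2 * ‖y‖ ^ 2

/-- The Fréchet subdifferential: `φ` is finite at `y` and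
`liminf_{w → y} (φ w - φ y - ⟪s, w - y⟫) / ‖w - y‖ ≥ 0`. -/
def frechetSubdiff (φ : E → EReal) (y : E) : Set E :=
  {s | φ y ≠ ⊤ ∧ φ y ≠ ⊥ ∧ ∀ ε : ℝ, 0 < ε → ∀ᶠ w in nhds y,
    φ y + ((inner ℝ s (w - y) - ε * ‖w - y‖ : ℝ) : EReal) ≤ φ w}

open Classical in
/-- The indicator function `δ_S`, equal to `0` on `S` and to `+∞` off `S`. -/
def indicatorFun (S : Set E) (x : E) : EReal := if x ∈ S then 0 else ⊤

/-- The metric projection onto `S`: a point of `S` nearest to `v`. -/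
def proj (S : Set E) (v : E) : E :=
  Classical.epsilon fun u => u ∈ S ∧ ∀ w ∈ S, ‖v - u‖ ≤ ‖v - w‖

/-- The proximal operator `prox_{τ φ}(v)`: a minimizer of `τ φ(u) + ‖u - v‖² / 2`. -/
def prox (τ : ℝ) (φ : E → EReal) (v : E) : E :=
  Classical.epsilon fun u => ∀ w,
    (τ : EReal) * φ u + ((‖u - v‖ ^ 2 / 2 : ℝ) : EReal) ≤
      (τ : EReal) * φ w + ((‖w - v‖ ^ 2 / 2 : ℝ) : EReal)

end ConvexAnalysis

/-- The data of a minimax problem `min_{x ∈ St} max_y f(x, y) - h(y)` over the Stiefel manifold,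
with the penalty parameter `ρ` and the radius `C` of its penalized reformulation. -/
structure Problem (d₁ r d₂ : ℕ) where
  f : XSpace d₁ r → YSpace d₂ → ℝ
  h : YSpace d₂ → EReal
  ρ : ℝ
  C : ℝ

namespace Problem

variable {d₁ r d₂ : ℕ} (P : Problem d₁ r d₂)

/-- `X = {x : ‖x‖ ≤ C}`. -/
def X : Set (XSpace d₁ r) := {x | ‖x‖ ≤ P.C}

/-- `X̄ = A(X)`. -/
def Xbar : Set (XSpace d₁ r) := dissolve '' P.X

/-- `Y = dom h`. -/
def Y : Set (YSpace d₂) := effDomain P.h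

/-- `∇ₓ f`. -/
def fGradX (x : XSpace d₁ r) (y : YSpace d₂) : XSpace d₁ r := gradient (fun u => P.f u y) x

/-- `∇_y f`. -/
def fGradY (x : XSpace d₁ r) (y : YSpace d₂) : YSpace d₂ := gradient (fun v => P.f x v) y

/-- `f_r(x, y) = f(x, y) - h(y)`; it is used for `y ∈ Y`, where `h(y)` is a real number. -/
def fr (x : XSpace d₁ r) (y : YSpace d₂) : ℝ := P.f x y - (P.h y).toReal

/-- `F(x) = max_y f_r(x, y)`; `f_r(x, ·)` is `-∞` off `Y`, so the maximum is over `Y`. -/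
def F (x : XSpace d₁ r) : ℝ := sSup (P.fr x '' P.Y)

/-- `F̄ = min_{x ∈ X} F(A(x))`. -/
def Fbar : ℝ := sInf ((fun x => P.F (dissolve x)) '' P.X)

/-- The penalized function `f̃(x, y) = f(A(x), y) + (ρ/4) ‖c(x)‖²`. -/
def ft (x : XSpace d₁ r) (y : YSpace d₂) : ℝ :=
  P.f (dissolve x) y + P.ρ / 4 * frobeniusSq (stiefelConstraint x)

/-- `∇ₓ f̃`. -/
def ftGradX (x : XSpace d₁ r) (y : YSpace d₂) : XSpace d₁ r := gradient (fun u => P.ft u y) x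

/-- `∇_y f̃`. -/
def ftGradY (x : XSpace d₁ r) (y : YSpace d₂) : YSpace d₂ := gradient (fun v => P.ft x v) y

/-- `f̂(x, y; z) = f̃(x, y) + (p/2) ‖x - z‖²`. -/
def fhat (p : ℝ) (x : XSpace d₁ r) (y : YSpace d₂) (z : XSpace d₁ r) : ℝ :=
  P.ft x y + p / 2 * ‖x - z‖ ^ 2

/-- `f̂_r(x, y; z) = f̂(x, y; z) - h(y)`, used for `y ∈ Y`. -/
def fhatr (p : ℝ) (x : XSpace d₁ r) (y : YSpace d₂) (z : XSpace d₁ r) : ℝ :=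
  P.fhat p x y z - (P.h y).toReal

/-- `Φ(x; z) = max_y f̂_r(x, y; z)`. -/
def Phi (p : ℝ) (x z : XSpace d₁ r) : ℝ := sSup ((fun y => P.fhatr p x y z) '' P.Y)

/-- `Ψ(y; z) = min_{x ∈ X} f̂(x, y; z)`. -/
def Psi (p : ℝ) (y : YSpace d₂) (z : XSpace d₁ r) : ℝ :=
  sInf ((fun x => P.fhat p x y z) '' P.X)

/-- `Ψ_r(y; z) = Ψ(y; z) - h(y)`, used for `y ∈ Y`. -/
def Psir (p : ℝ) (y : YSpace d₂) (z : XSpace d₁ r) : ℝ := P.Psi p y z - (P.h y).toReal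

/-- `P(z) = min_{x ∈ X} Φ(x; z)`. -/
def Pval (p : ℝ) (z : XSpace d₁ r) : ℝ := sInf ((fun x => P.Phi p x z) '' P.X)

/-- `Δ(x, y; z) = f̂_r(x, y; z) + P(z) - 2 Ψ_r(y; z)`. -/
def Delta (p : ℝ) (x : XSpace d₁ r) (y : YSpace d₂) (z : XSpace d₁ r) : ℝ :=
  P.fhatr p x y z + P.Pval p z - 2 * P.Psir p y z

/-- The duality gap `Φ(x; z) - Ψ_r(y; z)`. -/
def gap (p : ℝ) (x : XSpace d₁ r) (y : YSpace d₂) (z : XSpace d₁ r) : ℝ :=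
  P.Phi p x z - P.Psir p y z

/-- The regularizer `h` is proper, closed, `ζ`-weakly convex and locally Lipschitz on its domain
`Y`, and `Y` is closed and bounded. -/
structure RegularizerAssumption (ζ : ℝ) : Prop where
  zeta_nonneg : 0 ≤ ζ
  proper : IsProper P.h
  closed : LowerSemicontinuous P.h
  weaklyConvex : IsWeaklyConvex ζ P.h
  isClosed_domain : IsClosed P.Y
  locallyLipschitz : LocallyLipschitzOn P.Y fun y => (P.h y).toReal
  bounded_domain : Bornology.IsBounded P.Y

/-- `f` is differentiable on an open set containing `X̄ × Y`, and its partial gradients are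
Lipschitz on `X̄ × Y`. -/
structure SmoothnessAssumption : Prop where
  differentiable : ∃ U : Set (XSpace d₁ r × YSpace d₂), IsOpen U ∧ P.Xbar ×ˢ P.Y ⊆ U ∧
    DifferentiableOn ℝ (fun q : XSpace d₁ r × YSpace d₂ => P.f q.1 q.2) U
  lipschitz : ∃ Lxx Lxy Lyx Lyy : ℝ, 0 ≤ Lxx ∧ 0 ≤ Lxy ∧ 0 ≤ Lyx ∧ 0 ≤ Lyy ∧
    ∀ x₁ ∈ P.Xbar, ∀ x₂ ∈ P.Xbar, ∀ y₁ ∈ P.Y, ∀ y₂ ∈ P.Y,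
      ‖P.fGradX x₁ y₁ - P.fGradX x₂ y₂‖ ≤ Lxx * ‖x₁ - x₂‖ + Lxy * ‖y₁ - y₂‖ ∧
      ‖P.fGradY x₁ y₁ - P.fGradY x₂ y₂‖ ≤ Lyx * ‖x₁ - x₂‖ + Lyy * ‖y₁ - y₂‖

/-- `-f_r(x, ·)` is `μ`-PL uniformly over `x ∈ X̄`:
`max_w f_r(x, w) - f_r(x, y) ≤ dist²(0, -∇_y f(x, y) + ∂h(y)) / (2μ)`,
where the distance to the empty set is `+∞`. -/
structure PLAssumption (μ : ℝ) : Prop where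
  mu_pos : 0 < μ
  pl : ∀ x ∈ P.Xbar, ∀ y ∈ P.Y,
    ENNReal.ofReal (P.F x - P.fr x y) ≤ ENNReal.ofReal (1 / (2 * μ)) *
      Metric.infEDist 0 ((fun g => -P.fGradY x y + g) '' frechetSubdiff P.h y) ^ 2

/-- `l > 0` is a Lipschitz constant of the partial gradients of `f̃` on `X × Y`, that is, `l`
dominates constants `l_xx, l_xy, l_yx, l_yy` in the corresponding block estimates. -/
def IsSmoothnessConst (l : ℝ) : Prop :=
  0 < l ∧ ∀ x₁ ∈ P.X, ∀ x₂ ∈ P.X, ∀ y₁ ∈ P.Y, ∀ y₂ ∈ P.Y,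
    ‖P.ftGradX x₁ y₁ - P.ftGradX x₂ y₂‖ ≤ l * ‖x₁ - x₂‖ + l * ‖y₁ - y₂‖ ∧
    ‖P.ftGradY x₁ y₁ - P.ftGradY x₂ y₂‖ ≤ l * ‖x₁ - x₂‖ + l * ‖y₁ - y₂‖

/-- An iterate `(x, y, z)` of the algorithm. -/
structure Iterate (d₁ r d₂ : ℕ) where
  x : XSpace d₁ r
  y : YSpace d₂
  z : XSpace d₁ r

/-- The direction `g = ∇A(x)[∇ₓ f(A(x), y)] + (ρ/2) ∇c(x)[c(x)]`. -/
def direction (x : XSpace d₁ r) (y : YSpace d₂) : XSpace d₁ r :=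
  dissolveGrad x (P.fGradX (dissolve x) y) +
    (P.ρ / 2) • constraintGrad x (stiefelConstraint x)

/-- One iteration of smoothed MGDA. -/
def step (τ₁ τ₂ θ p β : ℝ) (s : Iterate d₁ r d₂) : Iterate d₁ r d₂ :=
  let x' := proj P.X (s.x - τ₁ • (P.direction s.x s.y + p • (s.x - s.z)))
  let y' := prox τ₂ P.h (s.y + τ₂ • (P.fGradY (dissolve x') s.y - θ • s.y))
  { x := x', y := y', z := s.z + β • (x' - s.z) }

/-- The smoothed MGDA sequence started at `s₀`, with primal step sizes `τ₁ t` and dual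
regularization parameters `θ t`. -/
def smMGDA (τ₁ θ : ℕ → ℝ) (τ₂ p β : ℝ) (s₀ : Iterate d₁ r d₂) : ℕ → Iterate d₁ r d₂
  | 0 => s₀
  | t + 1 => P.step (τ₁ t) τ₂ (θ t) p β (smMGDA τ₁ θ τ₂ p β s₀ t)

/-- `G^x_{t+1}`, in terms of two successive iterates `s = s_t`, `s' = s_{t+1}`. -/
def stepGx (τ₁ p : ℝ) (s s' : Iterate d₁ r d₂) : XSpace d₁ r :=
  (1 / τ₁) • (s.x - s'.x) + P.ftGradX s'.x s'.y - P.ftGradX s.x s.y + p • (s.z - s.x)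

/-- `G^y_{t+1}`, in terms of two successive iterates `s = s_t`, `s' = s_{t+1}`. -/
def stepGy (τ₂ : ℝ) (s s' : Iterate d₁ r d₂) : YSpace d₂ :=
  (1 / τ₂) • (s'.y - s.y) + P.ftGradY s'.x s'.y - P.ftGradY s'.x s.y

/-- `∇ₓ f̃(x, y) + ∂δ_X(x)`. -/
def xSubdiff (x : XSpace d₁ r) (y : YSpace d₂) : Set (XSpace d₁ r) :=
  (fun g => P.ftGradX x y + g) '' frechetSubdiff (indicatorFun P.X) x

/-- `-∇_y f̃(x, y) + ∂h(y)`. -/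
def ySubdiff (x : XSpace d₁ r) (y : YSpace d₂) : Set (YSpace d₂) :=
  (fun g => -P.ftGradY x y + g) '' frechetSubdiff P.h y

/-- `(x, y)` is an `ε`-stationary point of the ball-constrained penalized problem. -/
def IsApproxStationary (ε : ℝ) (x : XSpace d₁ r) (y : YSpace d₂) : Prop :=
  x ∈ P.X ∧ y ∈ P.Y ∧
    Metric.infEDist 0 (P.xSubdiff x y) ≤ ENNReal.ofReal ε ∧
    Metric.infEDist 0 (P.ySubdiff x y) ≤ ENNReal.ofReal ε

end Problem

end SmMGDA

end

/-! The proof is a Lyapunov argument for `potential`, `V = f̂_r - 2Ψ_r + 2P`. Writing `V = (f̂_r -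
Ψ_r) + (P - Ψ_r) + P` shows `V ≥ P ≥ F̄`, and at the start `V - F̄ = P(z₀) - F̄ + Δ₀`. So it
suffices that each iteration lowers `V` by a multiple of the squared residuals; the sum then
telescopes.

With `p = 2l`, `f̂(·, y; z)` and `Φ(·; z)` are `l`-strongly convex, so their minimizers exist and
the former move stably with `y` and `z`. Each of the three updates changes `V` in a controlled way.
The projected gradient step lowers `f̂`. The proximal ascent step may raise `f̂_r`, but it raises
`Ψ_r` by about the same amount, and the weight `-2` turns this into a net decrease, up to the
distance from `x'` to the inner minimizer (`dual_step_potential`); that distance is controlled by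
the primal step length (`norm_step_sub_argmin_le`). The averaging step gains a multiple of `‖x' -
z‖²`, up to an error `4βl‖u - x*‖²`, where `u` minimizes `f̂(·, y'; z)` and `x*` minimizes `Φ(·; z)`
(`center_step_potential`).

This last error is where PL enters, with no concavity in `y`. Strong convexity bounds `(l/2)‖u -
x*‖²` by `Φ(u; z) - P(z)`, hence by `Φ(u; z) - Ψ_r(y'; z) = Φ(u; z) - f̂_r(u, y'; z)`, and PL bounds
that by a squared dual residual over `2μ` (`norm_argmin_sub_argmin_Phi_sq_le`). The optimality
condition of the proximal step expresses that residual through the primal and dual step lengths.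
Since `β` carries the factor `min μ l · τ₂`, the error is absorbed (`descent_arith`,
`step_potential`).

The vectors `G^x`, `G^y` are the optimality conditions of the two steps, transported to the new
iterate, so they are bounded by the same step lengths. Because `κ̄ · min μ l = l`, dividing by the
small weight `β` costs exactly one factor `κ̄` (`stationarity_arith`). -/

namespace SmMGDA

/-- The image of a real set of values under a translation has the translated supremum. -/
theorem sSup_image_add_const {F : Type*} {t : Set F} (ht : t.Nonempty) {f : F → ℝ}
    (hb : BddAbove (f '' t)) (c : ℝ) :
    sSup ((fun y => f y + c) '' t) = sSup (f '' t) + c := by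
  apply le_antisymm
  · refine csSup_le (ht.image _) ?_
    rintro _ ⟨y, hy, rfl⟩
    have := le_csSup hb ⟨y, hy, rfl⟩
    simpa using this
  · rw [← le_sub_iff_add_le]
    refine csSup_le (ht.image _) ?_
    rintro _ ⟨y, hy, rfl⟩
    rw [le_sub_iff_add_le]
    refine le_csSup ?_ ⟨y, hy, rfl⟩
    obtain ⟨B, hB⟩ := hb
    refine ⟨B + c, ?_⟩
    rintro _ ⟨y, hy, rfl⟩
    have := hB ⟨y, hy, rfl⟩
    simpa using this

/-! ### Projections and proximal points as genuine minimizers -/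

section Normed

variable {E : Type*} [NormedAddCommGroup E]

/-- `proj` is a bare choice, so its defining property is available only once a nearest point is
known to exist; properness of the space supplies one. -/
theorem proj_spec [ProperSpace E] {s : Set E} (hs : IsClosed s) (hne : s.Nonempty) (v : E) :
    proj s v ∈ s ∧ ∀ w ∈ s, ‖v - proj s v‖ ≤ ‖v - w‖ := by
  refine Classical.epsilon_spec (p := fun u => u ∈ s ∧ ∀ w ∈ s, ‖v - u‖ ≤ ‖v - w‖) ?_
  obtain ⟨u, hu, h⟩ := hs.exists_infDist_eq_dist hne v
  refine ⟨u, hu, fun w hw => ?_⟩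
  rw [← dist_eq_norm, ← dist_eq_norm, ← h]
  exact Metric.infDist_le_dist_of_mem hw

/-- The proximal point minimizes the real-valued proximal objective over the effective domain. -/
theorem prox_spec {φ : E → EReal} (hφ : IsProper φ) (hK : IsCompact (effDomain φ))
    (hcont : ContinuousOn (fun y => (φ y).toReal) (effDomain φ)) {τ : ℝ} (hτ : 0 < τ) (v : E) :
    prox τ φ v ∈ effDomain φ ∧ ∀ w ∈ effDomain φ,
      τ * (φ (prox τ φ v)).toReal + ‖prox τ φ v - v‖ ^ 2 / 2 ≤
        τ * (φ w).toReal + ‖w - v‖ ^ 2 / 2 := by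
  have hcoe : ∀ w ∈ effDomain φ, (τ : EReal) * φ w + ((‖w - v‖ ^ 2 / 2 : ℝ) : EReal) =
      ((τ * (φ w).toReal + ‖w - v‖ ^ 2 / 2 : ℝ) : EReal) := by
    intro w hw
    rw [EReal.coe_add, EReal.coe_mul, EReal.coe_toReal hw.ne (hφ.1 w).ne']
  -- Off the domain the objective is `⊤`, so minimizing over the whole space is the same as
  -- minimizing a continuous real function over a compact set.
  have htop : ∀ w ∉ effDomain φ,
      (τ : EReal) * φ w + ((‖w - v‖ ^ 2 / 2 : ℝ) : EReal) = ⊤ := by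
    intro w hw
    have : φ w = ⊤ := by simpa [effDomain] using hw
    rw [this, EReal.coe_mul_top_of_pos hτ, EReal.top_add_coe]
  have hex : ∃ u, ∀ w, (τ : EReal) * φ u + ((‖u - v‖ ^ 2 / 2 : ℝ) : EReal) ≤
      (τ : EReal) * φ w + ((‖w - v‖ ^ 2 / 2 : ℝ) : EReal) := by
    have hc : ContinuousOn (fun w => τ * (φ w).toReal + ‖w - v‖ ^ 2 / 2) (effDomain φ) := by
      fun_prop
    obtain ⟨u, hu, hmin⟩ := hK.exists_isMinOn hφ.2 hc
    refine ⟨u, fun w => ?_⟩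
    by_cases hw : w ∈ effDomain φ
    · rw [hcoe u hu, hcoe w hw, EReal.coe_le_coe_iff]
      exact hmin hw
    · rw [htop w hw]; exact le_top
  have hspec : ∀ w, (τ : EReal) * φ (prox τ φ v) + ((‖prox τ φ v - v‖ ^ 2 / 2 : ℝ) : EReal) ≤
      (τ : EReal) * φ w + ((‖w - v‖ ^ 2 / 2 : ℝ) : EReal) := Classical.epsilon_spec hex
  have hmem : prox τ φ v ∈ effDomain φ := by
    by_contra hn
    obtain ⟨w, hw⟩ := hφ.2
    have := hspec w
    rw [htop _ hn, hcoe w hw] at this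
    exact (EReal.coe_lt_top _).not_ge this
  refine ⟨hmem, fun w hw => ?_⟩
  have := hspec w
  rwa [hcoe _ hmem, hcoe w hw, EReal.coe_le_coe_iff] at this

end Normed

/-! ### Quadratic bounds, strong convexity and subgradients in a Hilbert space -/

section General

variable {E : Type*} [NormedAddCommGroup E] [InnerProductSpace ℝ E]

/-- The quadratic upper bound for a function with `l`-Lipschitz gradient on a convex set. -/
theorem le_add_inner_add_of_lipschitz_gradient [CompleteSpace E] {s : Set E} (hs : Convex ℝ s)
    {f : E → ℝ} {g : E → E} {l : ℝ} (hf : ∀ x ∈ s, HasGradientAt f (g x) x)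
    (hg : ∀ x ∈ s, ∀ y ∈ s, ‖g x - g y‖ ≤ l * ‖x - y‖) {x w : E} (hx : x ∈ s) (hw : w ∈ s) :
    f w ≤ f x + inner ℝ (g x) (w - x) + l / 2 * ‖w - x‖ ^ 2 := by
  set d := w - x with hd
  have hmem : ∀ t ∈ Set.Icc (0 : ℝ) 1, x + t • d ∈ s := fun t ht =>
    hs.add_smul_sub_mem hx hw ht
  -- The error of the quadratic model along the segment has nonpositive derivative by Cauchy–Schwarz
  -- and the Lipschitz bound, so it decreases from `t = 0` to `t = 1`.
  have hder : ∀ t ∈ Set.Icc (0 : ℝ) 1,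
      HasDerivAt (fun t : ℝ => f (x + t • d) - t * inner ℝ (g x) d - l / 2 * t ^ 2 * ‖d‖ ^ 2)
        (inner ℝ (g (x + t • d)) d - inner ℝ (g x) d - l * t * ‖d‖ ^ 2) t := by
    intro t ht
    have h1 : HasDerivAt (fun t : ℝ => x + t • d) d t := by
      simpa using ((hasDerivAt_id t).smul_const d).const_add x
    have h2 := (hf _ (hmem t ht)).hasFDerivAt.comp_hasDerivAt t h1
    have h3 : HasDerivAt (fun t : ℝ => t * inner ℝ (g x) d) (inner ℝ (g x) d) t := by
      simpa using (hasDerivAt_id t).mul_const (inner ℝ (g x) d)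
    have h4 : HasDerivAt (fun t : ℝ => l / 2 * t ^ 2 * ‖d‖ ^ 2) (l * t * ‖d‖ ^ 2) t := by
      have := (((hasDerivAt_id t).pow 2).const_mul (l / 2)).mul_const (‖d‖ ^ 2)
      refine this.congr_deriv ?_
      simp
      ring_nf
      simp
    exact (h2.sub h3).sub h4
  have hanti := antitoneOn_of_deriv_nonpos (convex_Icc (0 : ℝ) 1)
    (fun t ht => (hder t ht).continuousAt.continuousWithinAt)
    (fun t ht => (hder t (interior_subset ht)).differentiableAt.differentiableWithinAt)
    (fun t ht => by
      have ht' := interior_subset ht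
      rw [(hder t ht').deriv, ← inner_sub_left]
      have h1 : inner ℝ (g (x + t • d) - g x) d ≤ ‖g (x + t • d) - g x‖ * ‖d‖ :=
        real_inner_le_norm _ _
      have h2 := hg _ (hmem t ht') _ hx
      rw [add_sub_cancel_left, norm_smul, Real.norm_of_nonneg ht'.1] at h2
      nlinarith [norm_nonneg d])
  have := hanti (Set.left_mem_Icc.2 zero_le_one) (Set.right_mem_Icc.2 zero_le_one) zero_le_one
  simp only [one_smul, zero_smul, hd, add_sub_cancel, add_zero] at this
  rw [hd]
  linarith

/-- The quadratic lower bound for a function with `l`-Lipschitz gradient on a convex set. -/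
theorem add_inner_sub_le_of_lipschitz_gradient [CompleteSpace E] {s : Set E} (hs : Convex ℝ s)
    {f : E → ℝ} {g : E → E} {l : ℝ} (hf : ∀ x ∈ s, HasGradientAt f (g x) x)
    (hg : ∀ x ∈ s, ∀ y ∈ s, ‖g x - g y‖ ≤ l * ‖x - y‖) {x w : E} (hx : x ∈ s) (hw : w ∈ s) :
    f x + inner ℝ (g x) (w - x) - l / 2 * ‖w - x‖ ^ 2 ≤ f w := by
  have := le_add_inner_add_of_lipschitz_gradient (f := fun x => -f x) (g := fun x => -g x) (l := l)
    hs (fun x hx => by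
      have := (hf x hx).hasFDerivAt.neg
      rw [hasGradientAt_iff_hasFDerivAt]
      simpa using! this)
    (fun x hx y hy => by rw [← neg_sub', norm_neg]; exact hg x hx y hy) hx hw
  rw [inner_neg_left] at this
  linarith

/-- A first-order quadratic lower bound at every point gives strong convexity. -/
theorem strongConvexOn_of_first_order {s : Set E} (hs : Convex ℝ s) {f : E → ℝ} {g : E → E} {m : ℝ}
    (h : ∀ x ∈ s, ∀ w ∈ s, f x + inner ℝ (g x) (w - x) + m / 2 * ‖w - x‖ ^ 2 ≤ f w) :
    StrongConvexOn s m f := by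
  refine ⟨hs, fun x hx y hy a b ha hb hab => ?_⟩
  have hu := hs hx hy ha hb hab
  set u := a • x + b • y with hu'
  have e1 : x - u = b • (x - y) := by
    rw [hu', show a = 1 - b by linarith]; module
  have e2 : y - u = -(a • (x - y)) := by
    rw [hu', show b = 1 - a by linarith]; module
  have h1 := h u hu x hx
  have h2 := h u hu y hy
  rw [e1, inner_smul_right, norm_smul, Real.norm_of_nonneg hb] at h1
  rw [e2, inner_neg_right, norm_neg, inner_smul_right, norm_smul, Real.norm_of_nonneg ha] at h2
  simp only [smul_eq_mul]
  have h3 := add_le_add (mul_le_mul_of_nonneg_left h1 ha) (mul_le_mul_of_nonneg_left h2 hb)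
  have hb' : b = 1 - a := by linarith
  subst hb'
  nlinarith [h3]

/-- Quadratic growth of a strongly convex function away from its minimizer. -/
theorem StrongConvexOn.add_le_of_isMinOn {s : Set E} {f : E → ℝ} {m : ℝ}
    (hf : StrongConvexOn s m f) {x : E} (hx : x ∈ s) (hmin : IsMinOn f s x) {w : E} (hw : w ∈ s) :
    f x + m / 2 * ‖w - x‖ ^ 2 ≤ f w := by
  -- Compare `f x` with the value at `t w + (1 - t) x`, divide by `t`, then let `t → 0`. The sign of
  -- `m` plays no role.
  have key : ∀ t ∈ Set.Ioo (0 : ℝ) 1, f x + m / 2 * (1 - t) * ‖w - x‖ ^ 2 ≤ f w := by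
    intro t ht
    have h1 := hf.2 hw hx ht.1.le (sub_nonneg.2 ht.2.le) (by ring)
    have h2 := hmin (hf.1 hw hx ht.1.le (sub_nonneg.2 ht.2.le) (by ring))
    simp only [Set.mem_ofPred_eq, smul_eq_mul] at h1 h2
    have h3 := h2.trans h1
    have : t * (f x + m / 2 * (1 - t) * ‖w - x‖ ^ 2) ≤ t * f w := by linarith
    exact le_of_mul_le_mul_left this ht.1
  have hlim : Filter.Tendsto (fun t : ℝ => f x + m / 2 * (1 - t) * ‖w - x‖ ^ 2)
      (nhdsWithin 0 (Set.Ioo 0 1)) (nhds (f x + m / 2 * (1 - 0) * ‖w - x‖ ^ 2)) := by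
    apply Continuous.continuousWithinAt
    fun_prop
  have hne : (nhdsWithin (0 : ℝ) (Set.Ioo 0 1)).NeBot := by
    rw [nhdsWithin_Ioo_eq_nhdsGT one_pos]; infer_instance
  have := le_of_tendsto hlim (Filter.eventually_of_mem self_mem_nhdsWithin key)
  simpa using this

/-- The pointwise supremum of `m`-strongly convex functions is `m`-strongly convex. -/
theorem strongConvexOn_sSup_image {F : Type*} {s : Set E} {t : Set F} (ht : t.Nonempty)
    (hs : Convex ℝ s) {f : E → F → ℝ} {m : ℝ}
    (hf : ∀ y ∈ t, StrongConvexOn s m fun x => f x y) (hb : ∀ x ∈ s, BddAbove (f x '' t)) :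
    StrongConvexOn s m fun x => sSup (f x '' t) := by
  refine ⟨hs, fun x hx w hw a b ha hb' hab => csSup_le (ht.image _) ?_⟩
  rintro _ ⟨y, hy, rfl⟩
  refine ((hf y hy).2 hx hw ha hb' hab).trans ?_
  simp only [smul_eq_mul]
  gcongr
  · exact le_csSup (hb x hx) ⟨y, hy, rfl⟩
  · exact le_csSup (hb w hw) ⟨y, hy, rfl⟩

/-- The three-point inequality for a projected gradient step `x ↦ x'` of size `τ` with the
gradient `g` of `φ` at `x`. -/
theorem projected_gradient_three_point {s : Set E} {φ : E → ℝ} {x x' g : E} {m M τ : ℝ}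
    (hτ : 0 < τ)
    (hlow : ∀ w ∈ s, φ x + inner ℝ g (w - x) + m / 2 * ‖w - x‖ ^ 2 ≤ φ w)
    (hup : φ x' ≤ φ x + inner ℝ g (x' - x) + M / 2 * ‖x' - x‖ ^ 2)
    (hvi : ∀ w ∈ s, inner ℝ (x - τ • g - x') (w - x') ≤ 0) {w : E} (hw : w ∈ s) :
    φ x' ≤ φ w + 1 / (2 * τ) * (‖w - x‖ ^ 2 - ‖w - x'‖ ^ 2) - m / 2 * ‖w - x‖ ^ 2
      - (1 / (2 * τ) - M / 2) * ‖x' - x‖ ^ 2 := by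
  have h1 := hlow w hw
  have h2 := hvi w hw
  have e1 : w - x = (w - x') + (x' - x) := by abel
  have e2 : x - τ • g - x' = -(x' - x) - τ • g := by abel
  have h3 : ‖w - x‖ ^ 2 = ‖w - x'‖ ^ 2 + 2 * inner ℝ (w - x') (x' - x) + ‖x' - x‖ ^ 2 := by
    rw [e1, norm_add_sq_real]
  have h4 : inner ℝ g (w - x) = inner ℝ g (w - x') + inner ℝ g (x' - x) := by
    rw [e1, inner_add_right]
  rw [e2, inner_sub_left, inner_neg_left, real_inner_smul_left,
    real_inner_comm] at h2
  rw [h4] at h1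
  have h5 : -(1 / τ) * inner ℝ (w - x') (x' - x) ≤ inner ℝ g (w - x') := by
    rw [neg_mul, one_div, ← div_eq_inv_mul, ← neg_div, div_le_iff₀ hτ]; linarith
  have h6 : 1 / (2 * τ) * (‖w - x‖ ^ 2 - ‖w - x'‖ ^ 2) =
      1 / τ * inner ℝ (w - x') (x' - x) + 1 / (2 * τ) * ‖x' - x‖ ^ 2 := by
    rw [h3]; field_simp; ring
  linarith

/-- A `C¹` map is Lipschitz and bounded on a compact convex set. -/
theorem exists_lipschitz_bound_of_contDiff {G : Type*} [NormedAddCommGroup G] [NormedSpace ℝ G]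
    {f : E → G} (hf : ContDiff ℝ 1 f) {s : Set E} (hs : IsCompact s) (hc : Convex ℝ s) :
    ∃ K : ℝ, 0 ≤ K ∧ (∀ x ∈ s, ‖f x‖ ≤ K) ∧ ∀ x ∈ s, ∀ y ∈ s, ‖f x - f y‖ ≤ K * ‖x - y‖ := by
  obtain ⟨K₁, h₁⟩ := hs.exists_bound_of_continuousOn (hf.continuous_fderiv one_ne_zero).continuousOn
  obtain ⟨K₂, h₂⟩ := hs.exists_bound_of_continuousOn hf.continuous.continuousOn
  refine ⟨max 0 (max K₁ K₂), le_max_left _ _, fun x hx => (h₂ x hx).trans (by simp), ?_⟩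
  intro x hx y hy
  refine hc.norm_image_sub_le_of_norm_fderiv_le (𝕜 := ℝ)
    (fun z _ => (hf.differentiable one_ne_zero) z) (fun z hz => (h₁ z hz).trans (by simp)) hy hx

theorem inner_sub_proj_le_zero [ProperSpace E] {s : Set E} (hs : IsClosed s) (hc : Convex ℝ s)
    (hne : s.Nonempty) (v : E) {w : E} (hw : w ∈ s) :
    inner ℝ (v - proj s v) (w - proj s v) ≤ 0 := by
  obtain ⟨h1, h2⟩ := proj_spec hs hne v
  refine (norm_eq_iInf_iff_real_inner_le_zero hc h1).1 ?_ w hw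
  have : Nonempty s := hne.to_subtype
  refine le_antisymm (le_ciInf fun w => h2 w w.2) ?_
  exact ciInf_le (f := fun w : s => ‖v - w‖) ⟨0, by rintro _ ⟨w, rfl⟩; exact norm_nonneg _⟩ ⟨_, h1⟩

/-- A normal vector of `s` at `x` is a Fréchet subgradient of the indicator function. -/
theorem mem_frechetSubdiff_indicatorFun {s : Set E} {x v : E} (hx : x ∈ s)
    (hv : ∀ w ∈ s, inner ℝ v (w - x) ≤ 0) : v ∈ frechetSubdiff (indicatorFun s) x := by
  refine ⟨by simp [indicatorFun, hx], by simp [indicatorFun, hx], fun ε hε =>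
    Filter.Eventually.of_forall fun w => ?_⟩
  by_cases hw : w ∈ s
  · simp only [indicatorFun, hx, hw, if_true, zero_add]
    rw [← EReal.coe_zero, EReal.coe_le_coe_iff]
    have := hv w hw
    have := mul_nonneg hε.le (norm_nonneg (w - x))
    linarith
  · simp [indicatorFun, hw]

/-- A real proximal inequality on the effective domain gives a Fréchet subgradient. -/
theorem mem_frechetSubdiff_of_quadratic {φ : E → EReal} (hφ : ∀ y, ⊥ < φ y) {y v : E} {c : ℝ}
    (hy : y ∈ effDomain φ)
    (hv : ∀ w ∈ effDomain φ,
      (φ y).toReal + inner ℝ v (w - y) - c * ‖w - y‖ ^ 2 ≤ (φ w).toReal) :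
    v ∈ frechetSubdiff φ y := by
  refine ⟨hy.ne, (hφ y).ne', fun ε hε => ?_⟩
  -- Near `y` the factor `c‖w - y‖` is below `ε`, so the quadratic error is at most `ε‖w - y‖`.
  have hlim : Filter.Tendsto (fun w => c * ‖w - y‖) (nhds y) (nhds (c * ‖y - y‖)) := by
    apply Continuous.continuousAt; fun_prop
  have := hlim.eventually_lt_const (u := ε) (by simpa using hε)
  filter_upwards [this] with w hw
  by_cases hwd : w ∈ effDomain φ
  · rw [← EReal.coe_toReal hy.ne (hφ y).ne', ← EReal.coe_toReal hwd.ne (hφ w).ne',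
      ← EReal.coe_add, EReal.coe_le_coe_iff]
    have := hv w hwd
    nlinarith [norm_nonneg (w - y)]
  · have : φ w = ⊤ := by simpa [effDomain] using hwd
    rw [this]; exact le_top

end General

end SmMGDA

/-! ### Derivatives of the dissolving operator and of the penalty -/

namespace SmMGDA

section MatrixCalculus

open Matrix

variable {d₁ r : ℕ}

theorem toMat_add_smul (x v : XSpace d₁ r) (t : ℝ) : toMat (x + t • v) = toMat x + t • toMat v := by
  ext i j; simp [toMat]

theorem inner_ofMat (M : Matrix (Fin d₁) (Fin r) ℝ) (v : XSpace d₁ r) :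
    inner ℝ (ofMat M) v = (Mᵀ * toMat v).trace := by
  simp only [PiLp.inner_apply, RCLike.inner_apply, conj_trivial, Fintype.sum_prod_type, ofMat,
    Matrix.trace, Matrix.diag, Matrix.mul_apply, Matrix.transpose_apply, toMat, Matrix.of_apply]
  rw [Finset.sum_comm]
  simp only [mul_comm]

theorem toMat_ofMat (M : Matrix (Fin d₁) (Fin r) ℝ) : toMat (ofMat M) = M := rfl

theorem ofMat_toMat (x : XSpace d₁ r) : ofMat (toMat x) = x := rfl

/-- A differentiable function whose directional derivatives are `v ↦ ⟪g, v⟫` has gradient `g`. -/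
theorem hasGradientAt_of_hasDerivAt_line {E : Type*} [NormedAddCommGroup E] [InnerProductSpace ℝ E]
    [CompleteSpace E] {f : E → ℝ} {x g : E} (hf : DifferentiableAt ℝ f x)
    (h : ∀ v, HasDerivAt (fun t : ℝ => f (x + t • v)) (inner ℝ g v) 0) : HasGradientAt f g x := by
  rw [hasGradientAt_iff_hasFDerivAt]
  have : InnerProductSpace.toDual ℝ E g = fderiv ℝ f x := by
    ext v
    rw [InnerProductSpace.toDual_apply_apply]
    exact (h v).unique (hf.hasFDerivAt.hasLineDerivAt v)
  rw [this]
  exact hf.hasFDerivAt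

theorem contDiff_dissolve : ContDiff ℝ 2 (dissolve (d₁ := d₁) (r := r)) := by
  refine contDiff_euclidean.2 fun ij => ?_
  simp only [dissolve, ofMat, dissolveFactor, toMat, Matrix.mul_apply, Matrix.sub_apply,
    Matrix.smul_apply, Matrix.of_apply, Matrix.transpose_apply]
  fun_prop

theorem contDiff_constraintGrad :
    ContDiff ℝ 2 fun x : XSpace d₁ r => constraintGrad x (stiefelConstraint x) := by
  refine contDiff_euclidean.2 fun ij => ?_
  simp only [constraintGrad, ofMat, stiefelConstraint, toMat, Matrix.mul_apply, Matrix.sub_apply,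
    Matrix.smul_apply, Matrix.of_apply, Matrix.transpose_apply]
  fun_prop

theorem contDiff_frobeniusSq_stiefelConstraint :
    ContDiff ℝ 2 fun x : XSpace d₁ r => frobeniusSq (stiefelConstraint x) := by
  simp only [frobeniusSq, stiefelConstraint, toMat, Matrix.mul_apply, Matrix.sub_apply,
    Matrix.of_apply, Matrix.transpose_apply]
  fun_prop

/-- The derivative of the constraint dissolving operator in the direction `v`. -/
theorem fderiv_dissolve_apply (x v : XSpace d₁ r) :
    fderiv ℝ dissolve x v = ofMat (toMat v * dissolveFactor x -
      (1 / 2 : ℝ) • (toMat x * ((toMat x)ᵀ * toMat v + (toMat v)ᵀ * toMat x))) := by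
  have hd := (contDiff_dissolve.differentiable two_ne_zero x).hasFDerivAt.hasLineDerivAt v
  refine hd.unique ?_
  set N := (toMat x)ᵀ * toMat v + (toMat v)ᵀ * toMat x with hN
  -- Along a line `dissolve` is a cubic polynomial in `t`; the directional derivative is its linear
  -- coefficient.
  have hline : ∀ t : ℝ, dissolve (x + t • v) = dissolve x +
      t • ofMat (toMat v * dissolveFactor x - (1 / 2 : ℝ) • (toMat x * N)) +
      t ^ 2 • ofMat (-(1 / 2 : ℝ) • (toMat v * N + toMat x * ((toMat v)ᵀ * toMat v))) +
      t ^ 3 • ofMat (-(1 / 2 : ℝ) • (toMat v * ((toMat v)ᵀ * toMat v))) := by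
    intro t
    have e : dissolveFactor (x + t • v) = dissolveFactor x - (t / 2) • N -
        (t ^ 2 / 2) • ((toMat v)ᵀ * toMat v) := by
      simp only [dissolveFactor, hN, toMat_add_smul, transpose_add, transpose_smul, Matrix.add_mul,
        Matrix.mul_add, Matrix.smul_mul, Matrix.mul_smul]
      module
    have : toMat (x + t • v) * dissolveFactor (x + t • v) = toMat x * dissolveFactor x +
      t • (toMat v * dissolveFactor x - (1 / 2 : ℝ) • (toMat x * N)) +
      t ^ 2 • (-(1 / 2 : ℝ) • (toMat v * N + toMat x * ((toMat v)ᵀ * toMat v))) +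
      t ^ 3 • (-(1 / 2 : ℝ) • (toMat v * ((toMat v)ᵀ * toMat v))) := by
      rw [e, toMat_add_smul]
      simp only [Matrix.add_mul, Matrix.mul_sub, Matrix.smul_mul, Matrix.mul_smul, smul_smul]
      module
    rw [dissolve, this]
    rfl
  simp only [HasLineDerivAt, hline]
  set R₁ := ofMat (toMat v * dissolveFactor x - (1 / 2 : ℝ) • (toMat x * N))
  set R₂ := ofMat (-(1 / 2 : ℝ) • (toMat v * N + toMat x * ((toMat v)ᵀ * toMat v)))
  set R₃ := ofMat (-(1 / 2 : ℝ) • (toMat v * ((toMat v)ᵀ * toMat v)))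
  have h := ((((hasDerivAt_id (0 : ℝ)).smul_const R₁).const_add (dissolve x)).add
    ((hasDerivAt_pow 2 (0 : ℝ)).smul_const R₂)).add ((hasDerivAt_pow 3 (0 : ℝ)).smul_const R₃)
  refine h.congr_deriv ?_
  simp

/-- `dissolveGrad x` is the adjoint of the derivative of `dissolve` at `x`. -/
theorem inner_fderiv_dissolve (x u v : XSpace d₁ r) :
    inner ℝ u (fderiv ℝ dissolve x v) = inner ℝ (dissolveGrad x u) v := by
  rw [fderiv_dissolve_apply, ← ofMat_toMat u, inner_ofMat, toMat_ofMat, dissolveGrad,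
    inner_ofMat, toMat_ofMat]
  have hS : (dissolveFactor x)ᵀ = dissolveFactor x := by
    simp [dissolveFactor, transpose_mul]
  have h1 : ((toMat u)ᵀ * (toMat v * dissolveFactor x)).trace =
      ((toMat u * dissolveFactor x)ᵀ * toMat v).trace := by
    rw [transpose_mul, hS, ← Matrix.mul_assoc, Matrix.trace_mul_comm, Matrix.mul_assoc]
  -- The term containing `vᵀ` is brought to the form `⟪·, v⟫` by transposing inside the trace and
  -- using cyclicity; this is the source of the symmetrization in `dissolveGrad`.
  have h2 : ((toMat u)ᵀ * (toMat x * ((toMat v)ᵀ * toMat x))).trace =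
      ((toMat x)ᵀ * toMat u * ((toMat x)ᵀ * toMat v)).trace := by
    rw [← Matrix.trace_transpose]
    simp only [transpose_mul, transpose_transpose]
    rw [Matrix.mul_assoc, Matrix.mul_assoc, Matrix.trace_mul_comm, Matrix.mul_assoc,
      Matrix.trace_mul_comm]
    simp only [Matrix.mul_assoc]
  simp only [Matrix.mul_sub, Matrix.mul_smul, Matrix.mul_add, symPart, transpose_sub,
    transpose_smul, transpose_add, transpose_mul, transpose_transpose, Matrix.sub_mul,
    Matrix.smul_mul, Matrix.add_mul, trace_sub, trace_add, trace_smul, smul_eq_mul] at h1 h2 ⊢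
  rw [h1, h2]
  simp only [Matrix.mul_assoc]

/-- In adjoint form, Lipschitz and operator-norm bounds for the derivative of `dissolve` carry over
to `dissolveGrad`, since the adjoint is isometric. -/
theorem dissolveGrad_eq_adjoint (x u : XSpace d₁ r) :
    dissolveGrad x u = ContinuousLinearMap.adjoint (fderiv ℝ dissolve x) u := by
  refine ext_inner_right ℝ fun v => ?_
  rw [← inner_fderiv_dissolve, ContinuousLinearMap.adjoint_inner_left]

theorem frobeniusSq_eq_trace {r : ℕ} (M : Matrix (Fin r) (Fin r) ℝ) :
    frobeniusSq M = (Mᵀ * M).trace := by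
  simp only [frobeniusSq, Matrix.trace, Matrix.diag, Matrix.mul_apply, Matrix.transpose_apply, sq]
  rw [Finset.sum_comm]

theorem frobeniusSq_nonneg {r : ℕ} (M : Matrix (Fin r) (Fin r) ℝ) : 0 ≤ frobeniusSq M :=
  Finset.sum_nonneg fun _ _ => Finset.sum_nonneg fun _ _ => sq_nonneg _

/-- The gradient of `‖c(x)‖²` is `2 ∇c(x)[c(x)]`. -/
theorem hasGradientAt_frobeniusSq_stiefelConstraint (x : XSpace d₁ r) :
    HasGradientAt (fun x : XSpace d₁ r => frobeniusSq (stiefelConstraint x))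
      ((2 : ℝ) • constraintGrad x (stiefelConstraint x)) x := by
  refine hasGradientAt_of_hasDerivAt_line
    (contDiff_frobeniusSq_stiefelConstraint.differentiable two_ne_zero x) fun v => ?_
  set c := stiefelConstraint x with hc
  set N := (toMat x)ᵀ * toMat v + (toMat v)ᵀ * toMat x with hN
  set V := (toMat v)ᵀ * toMat v with hV
  have hcT : cᵀ = c := by simp [hc, stiefelConstraint, transpose_mul]
  -- Here the restriction to a line is a quartic in `t`, and again only the linear coefficient
  -- survives.
  have hline : ∀ t : ℝ, frobeniusSq (stiefelConstraint (x + t • v)) =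
      (cᵀ * c).trace + t * (2 * (cᵀ * N).trace) +
      t ^ 2 * (2 * (cᵀ * V).trace + (Nᵀ * N).trace) + t ^ 3 * (2 * (Nᵀ * V).trace) +
      t ^ 4 * (Vᵀ * V).trace := by
    intro t
    have e : stiefelConstraint (x + t • v) = c + t • N + t ^ 2 • V := by
      simp only [stiefelConstraint, hc, hN, hV, toMat_add_smul, transpose_add, transpose_smul,
        Matrix.add_mul, Matrix.mul_add, Matrix.smul_mul, Matrix.mul_smul]
      module
    have tr : ∀ A B : Matrix (Fin r) (Fin r) ℝ, (Aᵀ * B).trace = (Bᵀ * A).trace := fun A B => by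
      rw [← Matrix.trace_transpose, transpose_mul, transpose_transpose]
    rw [e, frobeniusSq_eq_trace]
    simp only [transpose_add, transpose_smul, Matrix.add_mul, Matrix.mul_add, Matrix.smul_mul,
      Matrix.mul_smul, trace_add, trace_smul, smul_eq_mul, tr N c, tr V c, tr V N]
    ring
  simp only [hline]
  have h := (((((hasDerivAt_id (0 : ℝ)).mul_const (2 * (cᵀ * N).trace)).const_add
    (cᵀ * c).trace).add ((hasDerivAt_pow 2 (0 : ℝ)).mul_const
      (2 * (cᵀ * V).trace + (Nᵀ * N).trace))).add ((hasDerivAt_pow 3 (0 : ℝ)).mul_const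
      (2 * (Nᵀ * V).trace))).add ((hasDerivAt_pow 4 (0 : ℝ)).mul_const (Vᵀ * V).trace)
  refine h.congr_deriv ?_
  have h2 : (c * ((toMat v)ᵀ * toMat x)).trace = (c * ((toMat x)ᵀ * toMat v)).trace := by
    rw [← Matrix.trace_transpose]
    simp only [transpose_mul, transpose_transpose, hcT]
    rw [Matrix.trace_mul_comm]
  rw [constraintGrad, real_inner_smul_left, inner_ofMat]
  simp only [transpose_smul, transpose_mul, hcT, Matrix.smul_mul, trace_smul, smul_eq_mul, hN,
    Matrix.mul_add, trace_add, h2, Matrix.mul_assoc]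
  norm_num
  ring

end MatrixCalculus

end SmMGDA

/-! ### The feasible sets, the gradients of the penalized function and their Lipschitz constant -/

namespace SmMGDA

namespace Problem

variable {d₁ r d₂ : ℕ} {P : Problem d₁ r d₂} {ζ : ℝ}

section Domains

theorem X_eq_closedBall : P.X = Metric.closedBall 0 P.C := by
  ext x; simp [X]

theorem convex_X : Convex ℝ P.X := by
  rw [X_eq_closedBall]; exact convex_closedBall _ _

theorem isCompact_X : IsCompact P.X := by
  rw [X_eq_closedBall]; exact isCompact_closedBall _ _

theorem nonempty_X (hC : 0 < P.C) : P.X.Nonempty := ⟨0, by simp [X, hC.le]⟩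

theorem RegularizerAssumption.convex_Y (hr : P.RegularizerAssumption ζ) : Convex ℝ P.Y :=
  hr.weaklyConvex.1

theorem RegularizerAssumption.isCompact_Y (hr : P.RegularizerAssumption ζ) : IsCompact P.Y :=
  Metric.isCompact_of_isClosed_isBounded hr.isClosed_domain hr.bounded_domain

theorem RegularizerAssumption.nonempty_Y (hr : P.RegularizerAssumption ζ) : P.Y.Nonempty :=
  hr.proper.2

theorem RegularizerAssumption.continuousOn_h (hr : P.RegularizerAssumption ζ) :
    ContinuousOn (fun y => (P.h y).toReal) P.Y :=
  hr.locallyLipschitz.continuousOn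

theorem dissolve_mem_Xbar {x : XSpace d₁ r} (hx : x ∈ P.X) : dissolve x ∈ P.Xbar := ⟨x, hx, rfl⟩

end Domains

section Gradients

theorem SmoothnessAssumption.differentiableAt (hs : P.SmoothnessAssumption) {x : XSpace d₁ r}
    {y : YSpace d₂} (hx : x ∈ P.X) (hy : y ∈ P.Y) :
    DifferentiableAt ℝ (fun q : XSpace d₁ r × YSpace d₂ => P.f q.1 q.2) (dissolve x, y) := by
  obtain ⟨U, hU, hsub, hd⟩ := hs.differentiable
  exact hd.differentiableAt (hU.mem_nhds (hsub ⟨dissolve_mem_Xbar hx, hy⟩))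

theorem SmoothnessAssumption.hasGradientAt_f_left (hs : P.SmoothnessAssumption) {x : XSpace d₁ r}
    {y : YSpace d₂} (hx : x ∈ P.X) (hy : y ∈ P.Y) :
    HasGradientAt (fun u => P.f u y) (P.fGradX (dissolve x) y) (dissolve x) := by
  refine DifferentiableAt.hasGradientAt ?_
  exact (hs.differentiableAt hx hy).comp (dissolve x)
    (f := fun u : XSpace d₁ r => ((u, y) : XSpace d₁ r × YSpace d₂)) (by fun_prop)

theorem SmoothnessAssumption.hasGradientAt_f_right (hs : P.SmoothnessAssumption) {x : XSpace d₁ r}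
    {y : YSpace d₂} (hx : x ∈ P.X) (hy : y ∈ P.Y) :
    HasGradientAt (fun v => P.f (dissolve x) v) (P.fGradY (dissolve x) y) y := by
  refine DifferentiableAt.hasGradientAt ?_
  exact (hs.differentiableAt hx hy).comp y
    (f := fun v : YSpace d₂ => ((dissolve x, v) : XSpace d₁ r × YSpace d₂)) (by fun_prop)

theorem SmoothnessAssumption.hasGradientAt_direction (hs : P.SmoothnessAssumption)
    {x : XSpace d₁ r} {y : YSpace d₂} (hx : x ∈ P.X) (hy : y ∈ P.Y) :
    HasGradientAt (fun u => P.ft u y) (P.direction x y) x := by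
  have h1 := (hs.hasGradientAt_f_left hx hy).hasFDerivAt.comp x
    (contDiff_dissolve.differentiable two_ne_zero x).hasFDerivAt
  have h2 := (hasGradientAt_frobeniusSq_stiefelConstraint x).hasFDerivAt.const_mul (P.ρ / 4)
  rw [hasGradientAt_iff_hasFDerivAt]
  refine (h1.add h2).congr_fderiv ?_
  ext v
  simp only [add_apply, ContinuousLinearMap.comp_apply,
    smul_apply, InnerProductSpace.toDual_apply_apply, inner_fderiv_dissolve,
    direction, inner_add_left, real_inner_smul_left, smul_eq_mul]
  ring

theorem SmoothnessAssumption.ftGradX_eq (hs : P.SmoothnessAssumption) {x : XSpace d₁ r}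
    {y : YSpace d₂} (hx : x ∈ P.X) (hy : y ∈ P.Y) : P.ftGradX x y = P.direction x y :=
  (hs.hasGradientAt_direction hx hy).gradient

theorem SmoothnessAssumption.hasGradientAt_ft_left (hs : P.SmoothnessAssumption)
    {x : XSpace d₁ r} {y : YSpace d₂} (hx : x ∈ P.X) (hy : y ∈ P.Y) :
    HasGradientAt (fun u => P.ft u y) (P.ftGradX x y) x := by
  rw [hs.ftGradX_eq hx hy]; exact hs.hasGradientAt_direction hx hy

/-- The penalty does not depend on `y`, so this holds at every point, with no differentiability
needed. -/
theorem ftGradY_eq (x : XSpace d₁ r) (y : YSpace d₂) :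
    P.ftGradY x y = P.fGradY (dissolve x) y := by
  simp only [ftGradY, fGradY, gradient, ft]
  rw [fderiv_add_const]

theorem SmoothnessAssumption.hasGradientAt_ft_right (hs : P.SmoothnessAssumption)
    {x : XSpace d₁ r} {y : YSpace d₂} (hx : x ∈ P.X) (hy : y ∈ P.Y) :
    HasGradientAt (fun v => P.ft x v) (P.ftGradY x y) y := by
  rw [ftGradY_eq]
  exact (hs.hasGradientAt_f_right hx hy).hasFDerivAt.add_const _

/-- The partial gradients of the penalized function are Lipschitz on `X × Y`. -/
theorem exists_isSmoothnessConst (hr : P.RegularizerAssumption ζ) (hs : P.SmoothnessAssumption) :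
    ∃ l, P.IsSmoothnessConst l := by
  obtain ⟨Lxx, Lxy, Lyx, Lyy, hLxx, hLxy, hLyx, hLyy, hL⟩ := hs.lipschitz
  obtain ⟨KA, hKA, -, hA⟩ := exists_lipschitz_bound_of_contDiff
    (contDiff_dissolve.of_le one_le_two) (isCompact_X (P := P)) convex_X
  obtain ⟨KD, hKD, hDb, hD⟩ := exists_lipschitz_bound_of_contDiff
    (contDiff_dissolve.fderiv_right (m := 1) (by norm_num)) (isCompact_X (P := P)) convex_X
  obtain ⟨Kc, hKc, -, hc⟩ := exists_lipschitz_bound_of_contDiff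
    (contDiff_constraintGrad.of_le one_le_two) (isCompact_X (P := P)) convex_X
  -- The product rule below needs a bound on `∇ₓf` itself; it follows from the Lipschitz estimate
  -- because `X` and `Y` are bounded.
  obtain ⟨B, hB⟩ : ∃ B : ℝ, ∀ x ∈ P.X, ∀ y ∈ P.Y, ‖P.fGradX (dissolve x) y‖ ≤ B := by
    rcases P.X.eq_empty_or_nonempty with h | ⟨x₀, hx₀⟩
    · exact ⟨0, by simp [h]⟩
    obtain ⟨y₀, hy₀⟩ := hr.nonempty_Y
    obtain ⟨R, hR⟩ := hr.isCompact_Y.isBounded.exists_norm_le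
    refine ⟨‖P.fGradX (dissolve x₀) y₀‖ + (Lxx * (KA * (P.C + P.C)) + Lxy * (R + R)), ?_⟩
    intro x hx y hy
    have h1 := (hL _ (dissolve_mem_Xbar hx) _ (dissolve_mem_Xbar hx₀) y hy y₀ hy₀).1
    have h2 := norm_sub_norm_le (P.fGradX (dissolve x) y) (P.fGradX (dissolve x₀) y₀)
    have h3 : ‖x - x₀‖ ≤ P.C + P.C := (norm_sub_le _ _).trans (add_le_add hx hx₀)
    have h4 : ‖y - y₀‖ ≤ R + R := (norm_sub_le _ _).trans (add_le_add (hR y hy) (hR y₀ hy₀))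
    have h5 := (hA x hx x₀ hx₀).trans (mul_le_mul_of_nonneg_left h3 hKA)
    have h6 := mul_le_mul_of_nonneg_left h5 hLxx
    have h7 := mul_le_mul_of_nonneg_left h4 hLxy
    linarith
  have hX : ∀ x₁ ∈ P.X, ∀ x₂ ∈ P.X, ∀ y₁ ∈ P.Y, ∀ y₂ ∈ P.Y,
      ‖P.ftGradX x₁ y₁ - P.ftGradX x₂ y₂‖ ≤
        (KD * B + KD * (Lxx * KA) + |P.ρ / 2| * Kc) * ‖x₁ - x₂‖ + KD * Lxy * ‖y₁ - y₂‖ := by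
    intro x₁ hx₁ x₂ hx₂ y₁ hy₁ y₂ hy₂
    rw [hs.ftGradX_eq hx₁ hy₁, hs.ftGradX_eq hx₂ hy₂, direction, direction,
      dissolveGrad_eq_adjoint, dissolveGrad_eq_adjoint]
    set D₁ := fderiv ℝ (dissolve (d₁ := d₁) (r := r)) x₁
    set D₂ := fderiv ℝ (dissolve (d₁ := d₁) (r := r)) x₂
    set u₁ := P.fGradX (dissolve x₁) y₁
    set u₂ := P.fGradX (dissolve x₂) y₂
    set c₁ := constraintGrad x₁ (stiefelConstraint x₁)
    set c₂ := constraintGrad x₂ (stiefelConstraint x₂)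
    -- Product-rule splitting: vary the operator with the vector fixed, then the vector with the
    -- operator fixed.
    have e : D₁.adjoint u₁ + (P.ρ / 2) • c₁ - (D₂.adjoint u₂ + (P.ρ / 2) • c₂) =
        (D₁ - D₂).adjoint u₁ + D₂.adjoint (u₁ - u₂) + (P.ρ / 2) • (c₁ - c₂) := by
      simp only [map_sub, sub_apply, smul_sub]
      abel
    have h1 : ‖(D₁ - D₂).adjoint u₁‖ ≤ KD * ‖x₁ - x₂‖ * B := by
      refine (ContinuousLinearMap.le_opNorm _ _).trans ?_
      rw [LinearIsometryEquiv.norm_map]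
      exact mul_le_mul (hD x₁ hx₁ x₂ hx₂) (hB x₁ hx₁ y₁ hy₁) (norm_nonneg _) (by positivity)
    have h2 : ‖D₂.adjoint (u₁ - u₂)‖ ≤
        KD * (Lxx * (KA * ‖x₁ - x₂‖) + Lxy * ‖y₁ - y₂‖) := by
      refine (ContinuousLinearMap.le_opNorm _ _).trans ?_
      rw [LinearIsometryEquiv.norm_map]
      refine mul_le_mul (hDb x₂ hx₂) ?_ (norm_nonneg _) hKD
      have := (hL _ (dissolve_mem_Xbar hx₁) _ (dissolve_mem_Xbar hx₂) y₁ hy₁ y₂ hy₂).1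
      have := mul_le_mul_of_nonneg_left (hA x₁ hx₁ x₂ hx₂) hLxx
      linarith
    have h3 : ‖(P.ρ / 2) • (c₁ - c₂)‖ ≤ |P.ρ / 2| * (Kc * ‖x₁ - x₂‖) := by
      rw [norm_smul, Real.norm_eq_abs]
      exact mul_le_mul_of_nonneg_left (hc x₁ hx₁ x₂ hx₂) (abs_nonneg _)
    rw [e]
    refine (norm_add₃_le).trans ?_
    linarith
  have hY : ∀ x₁ ∈ P.X, ∀ x₂ ∈ P.X, ∀ y₁ ∈ P.Y, ∀ y₂ ∈ P.Y,
      ‖P.ftGradY x₁ y₁ - P.ftGradY x₂ y₂‖ ≤ Lyx * KA * ‖x₁ - x₂‖ + Lyy * ‖y₁ - y₂‖ := by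
    intro x₁ hx₁ x₂ hx₂ y₁ hy₁ y₂ hy₂
    rw [ftGradY_eq, ftGradY_eq]
    have := (hL _ (dissolve_mem_Xbar hx₁) _ (dissolve_mem_Xbar hx₂) y₁ hy₁ y₂ hy₂).2
    have := mul_le_mul_of_nonneg_left (hA x₁ hx₁ x₂ hx₂) hLyx
    linarith
  set l₁ := KD * B + KD * (Lxx * KA) + |P.ρ / 2| * Kc
  refine ⟨1 + |l₁| + KD * Lxy + Lyx * KA + Lyy, by positivity, ?_⟩
  have hl₁ := le_abs_self l₁
  have hl₁' := abs_nonneg l₁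
  have q1 := mul_nonneg hKD hLxy
  have q2 := mul_nonneg hLyx hKA
  intro x₁ hx₁ x₂ hx₂ y₁ hy₁ y₂ hy₂
  refine ⟨(hX x₁ hx₁ x₂ hx₂ y₁ hy₁ y₂ hy₂).trans ?_, (hY x₁ hx₁ x₂ hx₂ y₁ hy₁ y₂ hy₂).trans ?_⟩ <;>
  · gcongr <;> linarith

end Gradients

end Problem

end SmMGDA

namespace SmMGDA

namespace Problem

variable {d₁ r d₂ : ℕ} {P : Problem d₁ r d₂} {ζ μ l p : ℝ}

/-- The standing assumptions on the problem, with a smoothness constant `l`. -/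
structure SaddleAssumption (P : Problem d₁ r d₂) (ζ μ l : ℝ) : Prop where
  C_pos : 0 < P.C
  rho_pos : 0 < P.ρ
  reg : P.RegularizerAssumption ζ
  smooth : P.SmoothnessAssumption
  pl : P.PLAssumption μ
  const : P.IsSmoothnessConst l

namespace SaddleAssumption

/-! ### Attainment and ordering of the value functions -/

section Values

theorem continuousOn_fr (H : P.SaddleAssumption ζ μ l) {x : XSpace d₁ r} (hx : x ∈ P.X) :
    ContinuousOn (P.fr (dissolve x)) P.Y :=
  ContinuousOn.sub (fun _ hy =>
    (H.smooth.hasGradientAt_f_right hx hy).continuousAt.continuousWithinAt) H.reg.continuousOn_h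

theorem bddAbove_fr (H : P.SaddleAssumption ζ μ l) {x : XSpace d₁ r} (hx : x ∈ P.X) :
    BddAbove (P.fr (dissolve x) '' P.Y) :=
  H.reg.isCompact_Y.bddAbove_image (H.continuousOn_fr hx)

theorem fhatr_eq (x z : XSpace d₁ r) (y : YSpace d₂) :
    P.fhatr p x y z = P.fr (dissolve x) y +
      (P.ρ / 4 * frobeniusSq (stiefelConstraint x) + p / 2 * ‖x - z‖ ^ 2) := by
  simp only [fhatr, fhat, ft, fr]; ring

/-- The penalty and the proximal term are constant in `y`, hence pass through the maximum. This lets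
the PL inequality for `f` act on `Φ - f̂_r`. -/
theorem Phi_eq (H : P.SaddleAssumption ζ μ l) {x : XSpace d₁ r} (hx : x ∈ P.X)
    (z : XSpace d₁ r) : P.Phi p x z = P.F (dissolve x) +
      (P.ρ / 4 * frobeniusSq (stiefelConstraint x) + p / 2 * ‖x - z‖ ^ 2) := by
  simp only [Phi, F, fhatr_eq]
  exact sSup_image_add_const H.reg.nonempty_Y (H.bddAbove_fr hx) _

theorem fr_le_F (H : P.SaddleAssumption ζ μ l) {x : XSpace d₁ r} (hx : x ∈ P.X) {y : YSpace d₂}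
    (hy : y ∈ P.Y) : P.fr (dissolve x) y ≤ P.F (dissolve x) :=
  le_csSup (H.bddAbove_fr hx) ⟨y, hy, rfl⟩

theorem fhatr_le_Phi (H : P.SaddleAssumption ζ μ l) {x : XSpace d₁ r} (hx : x ∈ P.X)
    {y : YSpace d₂} (hy : y ∈ P.Y) (z : XSpace d₁ r) : P.fhatr p x y z ≤ P.Phi p x z := by
  rw [H.Phi_eq hx, fhatr_eq]
  have := H.fr_le_F hx hy
  linarith

theorem bddAbove_fhatr (H : P.SaddleAssumption ζ μ l) {x : XSpace d₁ r} (hx : x ∈ P.X)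
    (z : XSpace d₁ r) : BddAbove ((fun y => P.fhatr p x y z) '' P.Y) :=
  ⟨P.Phi p x z, by rintro _ ⟨y, hy, rfl⟩; exact H.fhatr_le_Phi hx hy z⟩

theorem continuousOn_ft (H : P.SaddleAssumption ζ μ l) {y : YSpace d₂} (hy : y ∈ P.Y) :
    ContinuousOn (fun x => P.ft x y) P.X :=
  fun _ hx => (H.smooth.hasGradientAt_ft_left hx hy).continuousAt.continuousWithinAt

theorem continuousOn_fhat (H : P.SaddleAssumption ζ μ l) {y : YSpace d₂} (hy : y ∈ P.Y)
    (z : XSpace d₁ r) : ContinuousOn (fun x => P.fhat p x y z) P.X := by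
  refine (H.continuousOn_ft hy).add (Continuous.continuousOn ?_)
  fun_prop

theorem Fbar_le (H : P.SaddleAssumption ζ μ l) {x : XSpace d₁ r} (hx : x ∈ P.X) :
    P.Fbar ≤ P.F (dissolve x) := by
  refine csInf_le ?_ ⟨x, hx, rfl⟩
  obtain ⟨y, hy⟩ := H.reg.nonempty_Y
  have hc : ContinuousOn (fun x => P.fr (dissolve x) y) P.X := fun x hx =>
    (((H.smooth.hasGradientAt_f_left hx hy).continuousAt.comp
      contDiff_dissolve.continuous.continuousAt).sub continuousAt_const).continuousWithinAt
  obtain ⟨B, hB⟩ := isCompact_X.bddBelow_image hc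
  refine ⟨B, ?_⟩
  rintro _ ⟨x, hx, rfl⟩
  exact (hB ⟨x, hx, rfl⟩).trans (H.fr_le_F hx hy)

theorem Fbar_le_Phi (H : P.SaddleAssumption ζ μ l) (hp : 0 ≤ p) {x : XSpace d₁ r} (hx : x ∈ P.X)
    (z : XSpace d₁ r) : P.Fbar ≤ P.Phi p x z := by
  rw [H.Phi_eq hx]
  have h1 := H.Fbar_le hx
  have h2 := mul_nonneg (div_nonneg H.rho_pos.le zero_le_four)
    (frobeniusSq_nonneg (stiefelConstraint x))
  have h3 : 0 ≤ p / 2 * ‖x - z‖ ^ 2 := by positivity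
  linarith

/-- The inner minimization problem defining `Ψ(y; z)` has a solution. -/
theorem exists_argmin_fhat (H : P.SaddleAssumption ζ μ l) {y : YSpace d₂} (hy : y ∈ P.Y)
    (p : ℝ) (z : XSpace d₁ r) :
    ∃ x ∈ P.X, IsMinOn (fun x => P.fhat p x y z) P.X x ∧ P.Psi p y z = P.fhat p x y z := by
  obtain ⟨x, hx, hmin⟩ := isCompact_X.exists_isMinOn (nonempty_X H.C_pos)
    (H.continuousOn_fhat (p := p) hy z)
  refine ⟨x, hx, hmin, IsLeast.csInf_eq ⟨⟨x, hx, rfl⟩, ?_⟩⟩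
  rintro _ ⟨w, hw, rfl⟩
  exact hmin hw

theorem Psi_le_fhat (H : P.SaddleAssumption ζ μ l) {y : YSpace d₂} (hy : y ∈ P.Y)
    {x : XSpace d₁ r} (hx : x ∈ P.X) (z : XSpace d₁ r) : P.Psi p y z ≤ P.fhat p x y z := by
  obtain ⟨u, -, hmin, h⟩ := H.exists_argmin_fhat hy p z
  rw [h]; exact hmin hx

/-- The minimization problem defining `P(z)` has a solution. -/
theorem exists_argmin_Phi (H : P.SaddleAssumption ζ μ l) (p : ℝ) (z : XSpace d₁ r) :
    ∃ x ∈ P.X, IsMinOn (fun x => P.Phi p x z) P.X x ∧ P.Pval p z = P.Phi p x z := by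
  -- A supremum of continuous functions is lower semicontinuous, which is enough for a minimum on a
  -- compact set.
  have hlsc : LowerSemicontinuousOn (fun x => P.Phi p x z) P.X := by
    simp only [Phi, sSup_image']
    refine lowerSemicontinuousOn_ciSup (fun x hx => ?_) fun y => ?_
    · have := H.bddAbove_fhatr (p := p) hx z
      rwa [Set.image_eq_range] at this
    · exact ((H.continuousOn_fhat y.2 z).sub continuousOn_const).lowerSemicontinuousOn
  obtain ⟨x, hx, hmin⟩ := hlsc.exists_isMinOn (nonempty_X H.C_pos) isCompact_X
  refine ⟨x, hx, hmin, IsLeast.csInf_eq ⟨⟨x, hx, rfl⟩, ?_⟩⟩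
  rintro _ ⟨w, hw, rfl⟩
  exact hmin hw

theorem Pval_le_Phi (H : P.SaddleAssumption ζ μ l) {x : XSpace d₁ r} (hx : x ∈ P.X)
    (z : XSpace d₁ r) : P.Pval p z ≤ P.Phi p x z := by
  obtain ⟨u, -, hmin, h⟩ := H.exists_argmin_Phi p z
  rw [h]; exact hmin hx

theorem Fbar_le_Pval (H : P.SaddleAssumption ζ μ l) (hp : 0 ≤ p) (z : XSpace d₁ r) :
    P.Fbar ≤ P.Pval p z := by
  obtain ⟨u, hu, -, h⟩ := H.exists_argmin_Phi p z
  rw [h]; exact H.Fbar_le_Phi hp hu z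

theorem Psir_le_fhatr (H : P.SaddleAssumption ζ μ l) {y : YSpace d₂} (hy : y ∈ P.Y)
    {x : XSpace d₁ r} (hx : x ∈ P.X) (z : XSpace d₁ r) : P.Psir p y z ≤ P.fhatr p x y z :=
  sub_le_sub_right (H.Psi_le_fhat hy hx z) _

theorem Psir_le_Pval (H : P.SaddleAssumption ζ μ l) {y : YSpace d₂} (hy : y ∈ P.Y)
    (z : XSpace d₁ r) : P.Psir p y z ≤ P.Pval p z := by
  obtain ⟨u, hu, -, h⟩ := H.exists_argmin_Phi p z
  rw [h]; exact (H.Psir_le_fhatr hy hu z).trans (H.fhatr_le_Phi hu hy z)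

theorem Delta_nonneg (H : P.SaddleAssumption ζ μ l) {x : XSpace d₁ r} (hx : x ∈ P.X)
    {y : YSpace d₂} (hy : y ∈ P.Y) (z : XSpace d₁ r) : 0 ≤ P.Delta p x y z := by
  have h1 := H.Psir_le_fhatr (p := p) hy hx z
  have h2 := H.Psir_le_Pval (p := p) hy z
  rw [Delta]; linarith

theorem Delta_le_two_mul_gap (H : P.SaddleAssumption ζ μ l) {x : XSpace d₁ r} (hx : x ∈ P.X)
    {y : YSpace d₂} (hy : y ∈ P.Y) (z : XSpace d₁ r) :
    P.Delta p x y z ≤ 2 * P.gap p x y z := by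
  have h1 := H.fhatr_le_Phi (p := p) hx hy z
  have h2 := H.Pval_le_Phi (p := p) hx z
  rw [Delta, gap]; linarith

end Values

/-! ### Smoothness, strong convexity and the PL inequality for the regularized function -/

section Smoothness

theorem ft_right_le (H : P.SaddleAssumption ζ μ l) {x : XSpace d₁ r} (hx : x ∈ P.X)
    {y w : YSpace d₂} (hy : y ∈ P.Y) (hw : w ∈ P.Y) :
    P.ft x w ≤ P.ft x y + inner ℝ (P.ftGradY x y) (w - y) + l / 2 * ‖w - y‖ ^ 2 :=
  le_add_inner_add_of_lipschitz_gradient H.reg.convex_Y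
    (fun _ hv => H.smooth.hasGradientAt_ft_right hx hv)
    (fun u hu v hv => by simpa using (H.const.2 x hx x hx u hu v hv).2) hy hw

theorem le_ft_right (H : P.SaddleAssumption ζ μ l) {x : XSpace d₁ r} (hx : x ∈ P.X)
    {y w : YSpace d₂} (hy : y ∈ P.Y) (hw : w ∈ P.Y) :
    P.ft x y + inner ℝ (P.ftGradY x y) (w - y) - l / 2 * ‖w - y‖ ^ 2 ≤ P.ft x w :=
  add_inner_sub_le_of_lipschitz_gradient H.reg.convex_Y
    (fun _ hv => H.smooth.hasGradientAt_ft_right hx hv)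
    (fun u hu v hv => by simpa using (H.const.2 x hx x hx u hu v hv).2) hy hw

theorem prox_term_eq (x w z : XSpace d₁ r) : p / 2 * ‖w - z‖ ^ 2 =
    p / 2 * ‖x - z‖ ^ 2 + inner ℝ (p • (x - z)) (w - x) + p / 2 * ‖w - x‖ ^ 2 := by
  rw [show w - z = (x - z) + (w - x) by abel, norm_add_sq_real, real_inner_smul_left]
  ring

theorem fhat_le (H : P.SaddleAssumption ζ μ l) {y : YSpace d₂} (hy : y ∈ P.Y)
    {x w : XSpace d₁ r} (hx : x ∈ P.X) (hw : w ∈ P.X) (z : XSpace d₁ r) :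
    P.fhat (2 * l) w y z ≤ P.fhat (2 * l) x y z +
      inner ℝ (P.ftGradX x y + (2 * l) • (x - z)) (w - x) + 3 * l / 2 * ‖w - x‖ ^ 2 := by
  have := le_add_inner_add_of_lipschitz_gradient convex_X
    (fun _ hv => H.smooth.hasGradientAt_ft_left hv hy)
    (fun u hu v hv => by simpa using (H.const.2 u hu v hv y hy y hy).1) hx hw
  rw [fhat, fhat, prox_term_eq x w z, inner_add_left]
  linarith

/-- The proximal term contributes curvature `2l` and `f̃` loses at most `l`, leaving modulus `l`;
this is the purpose of `p = 2l`. -/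
theorem le_fhat (H : P.SaddleAssumption ζ μ l) {y : YSpace d₂} (hy : y ∈ P.Y)
    {x w : XSpace d₁ r} (hx : x ∈ P.X) (hw : w ∈ P.X) (z : XSpace d₁ r) :
    P.fhat (2 * l) x y z + inner ℝ (P.ftGradX x y + (2 * l) • (x - z)) (w - x) +
      l / 2 * ‖w - x‖ ^ 2 ≤ P.fhat (2 * l) w y z := by
  have := add_inner_sub_le_of_lipschitz_gradient convex_X
    (fun _ hv => H.smooth.hasGradientAt_ft_left hv hy)
    (fun u hu v hv => by simpa using (H.const.2 u hu v hv y hy y hy).1) hx hw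
  rw [fhat, fhat, prox_term_eq x w z, inner_add_left]
  linarith

theorem strongConvexOn_fhat (H : P.SaddleAssumption ζ μ l) {y : YSpace d₂} (hy : y ∈ P.Y)
    (z : XSpace d₁ r) : StrongConvexOn P.X l fun x => P.fhat (2 * l) x y z :=
  strongConvexOn_of_first_order convex_X fun _ hx _ hw => H.le_fhat hy hx hw z

theorem strongConvexOn_Phi (H : P.SaddleAssumption ζ μ l) (z : XSpace d₁ r) :
    StrongConvexOn P.X l fun x => P.Phi (2 * l) x z := by
  refine strongConvexOn_sSup_image (f := fun x y => P.fhatr (2 * l) x y z) H.reg.nonempty_Y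
    convex_X (fun y hy => ?_) fun x hx => H.bddAbove_fhatr hx z
  refine ⟨convex_X, fun x hx w hw a b ha hb hab => ?_⟩
  have := (H.strongConvexOn_fhat hy z).2 hx hw ha hb hab
  simp only [fhatr, smul_eq_mul] at this ⊢
  have hb' : b = 1 - a := by linarith
  subst hb'
  linarith

/-- The PL inequality for the regularized function, in terms of any dual subgradient. -/
theorem Phi_sub_fhatr_le (H : P.SaddleAssumption ζ μ l) {x : XSpace d₁ r} (hx : x ∈ P.X)
    {y : YSpace d₂} (hy : y ∈ P.Y) (z : XSpace d₁ r) {v : YSpace d₂}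
    (hv : v ∈ frechetSubdiff P.h y) :
    P.Phi p x z - P.fhatr p x y z ≤ 1 / (2 * μ) * ‖v - P.ftGradY x y‖ ^ 2 := by
  have hμ := H.pl.mu_pos
  have h1 := H.pl.pl _ (dissolve_mem_Xbar hx) y hy
  have h2 : Metric.infEDist 0 ((fun g => -P.fGradY (dissolve x) y + g) '' frechetSubdiff P.h y) ≤
      ENNReal.ofReal ‖v - P.ftGradY x y‖ := by
    refine (Metric.infEDist_le_edist_of_mem (Set.mem_image_of_mem _ hv)).trans_eq ?_
    rw [edist_comm, edist_zero_right, ← ofReal_norm, ftGradY_eq, neg_add_eq_sub]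
  -- One subgradient `v` bounds the distance by a finite number, so the extended inequality descends
  -- to the reals.
  have h3 := h1.trans (mul_le_mul_right (pow_le_pow_left' h2 2) _)
  rw [← ENNReal.ofReal_pow (norm_nonneg _), ← ENNReal.ofReal_mul (by positivity),
    ENNReal.ofReal_le_ofReal_iff (by positivity)] at h3
  rw [H.Phi_eq hx, fhatr_eq]
  linarith

end Smoothness

end SaddleAssumption

end Problem

end SmMGDA

/-! ### The proximal step -/

namespace SmMGDA

section Prox

variable {E : Type*} [NormedAddCommGroup E] [InnerProductSpace ℝ E]

/-- The optimality condition of the proximal operator. -/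
theorem prox_mem_frechetSubdiff {φ : E → EReal} (hφ : IsProper φ) (hK : IsCompact (effDomain φ))
    (hcont : ContinuousOn (fun y => (φ y).toReal) (effDomain φ)) {τ : ℝ} (hτ : 0 < τ) (v : E) :
    (1 / τ) • (v - prox τ φ v) ∈ frechetSubdiff φ (prox τ φ v) := by
  obtain ⟨h1, h2⟩ := prox_spec hφ hK hcont hτ v
  refine mem_frechetSubdiff_of_quadratic (c := 1 / (2 * τ)) hφ.1 h1 fun w hw => ?_
  have h3 := h2 w hw
  set u := prox τ φ v
  rw [show w - v = (w - u) - (v - u) by abel, norm_sub_sq_real (w - u), norm_sub_rev u v] at h3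
  rw [real_inner_smul_left, real_inner_comm]
  have h4 : τ * ((φ u).toReal + 1 / τ * inner ℝ (w - u) (v - u) - 1 / (2 * τ) * ‖w - u‖ ^ 2) ≤
      τ * (φ w).toReal := by
    have : τ * ((φ u).toReal + 1 / τ * inner ℝ (w - u) (v - u) - 1 / (2 * τ) * ‖w - u‖ ^ 2) =
      τ * (φ u).toReal + inner ℝ (w - u) (v - u) - ‖w - u‖ ^ 2 / 2 := by field_simp
    linarith
  exact le_of_mul_le_mul_left h4 hτ

/-- The descent inequality of a proximal ascent step for a weakly convex function. -/
theorem prox_step_descent {φ : E → EReal} {ζ : ℝ} (hφ : IsProper φ) (hK : IsCompact (effDomain φ))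
    (hcont : ContinuousOn (fun y => (φ y).toReal) (effDomain φ)) (hw : IsWeaklyConvex ζ φ)
    {τ : ℝ} (hτ : 0 < τ) {y : E} (hy : y ∈ effDomain φ) (g : E) :
    (1 / τ - ζ / 2) * ‖prox τ φ (y + τ • g) - y‖ ^ 2 ≤
      inner ℝ g (prox τ φ (y + τ • g) - y) - (φ (prox τ φ (y + τ • g))).toReal +
        (φ y).toReal := by
  set v := y + τ • g with hv
  obtain ⟨h1, h2⟩ := prox_spec hφ hK hcont hτ v
  set u := prox τ φ v
  -- Quadratic growth of this objective at its minimizer adds `(1 - τζ)/2` to the `1/2` coming from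
  -- the square, which yields the coefficient `1/τ - ζ/2` after division by `τ`.
  have hsc : StrongConvexOn (effDomain φ) (1 - τ * ζ)
      fun w => τ * (φ w).toReal + ‖w - v‖ ^ 2 / 2 := by
    rw [strongConvexOn_iff_convex]
    have ha : ConvexOn ℝ (effDomain φ) fun w => ‖v‖ ^ 2 / 2 - inner ℝ v w := by
      refine ⟨hw.1, fun a _ b _ s t _ _ hst => le_of_eq ?_⟩
      simp only [inner_add_right, inner_smul_right, smul_eq_mul]
      have : t = 1 - s := by linarith
      subst this; ring
    refine ((hw.smul hτ.le).add ha).congr fun w _ => ?_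
    simp only [Pi.add_apply, smul_eq_mul]
    rw [norm_sub_sq_real, real_inner_comm]
    ring
  have h3 := StrongConvexOn.add_le_of_isMinOn hsc h1 (fun w hw => h2 w hw) hy
  have e1 : y - v = -(τ • g) := by rw [hv]; abel
  have e2 : u - v = (u - y) - τ • g := by rw [hv]; abel
  rw [e1, e2, norm_neg, norm_sub_sq_real, ← norm_neg (y - u), neg_sub,
    real_inner_smul_right, real_inner_comm] at h3
  have h4 : τ * ((1 / τ - ζ / 2) * ‖u - y‖ ^ 2) ≤
      τ * (inner ℝ g (u - y) - (φ u).toReal + (φ y).toReal) := by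
    have : τ * ((1 / τ - ζ / 2) * ‖u - y‖ ^ 2) = (1 - τ * ζ / 2) * ‖u - y‖ ^ 2 := by field_simp
    linarith
  exact le_of_mul_le_mul_left h4 hτ

end Prox

namespace Problem

variable {d₁ r d₂ : ℕ} {P : Problem d₁ r d₂} {ζ μ l p : ℝ}

namespace SaddleAssumption

/-! ### Stability of the inner minimizers and the PL error bound -/

section ErrorBounds

/-- The minimizer of `f̂(·, y; z)` is `2`-Lipschitz in `z`. -/
theorem norm_argmin_sub_le_center (H : P.SaddleAssumption ζ μ l) {y : YSpace d₂} (hy : y ∈ P.Y)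
    {z₁ z₂ x₁ x₂ : XSpace d₁ r} (hx₁ : x₁ ∈ P.X) (hx₂ : x₂ ∈ P.X)
    (h₁ : IsMinOn (fun x => P.fhat (2 * l) x y z₁) P.X x₁)
    (h₂ : IsMinOn (fun x => P.fhat (2 * l) x y z₂) P.X x₂) :
    ‖x₁ - x₂‖ ≤ 2 * ‖z₁ - z₂‖ := by
  have hl := H.const.1
  have a1 := StrongConvexOn.add_le_of_isMinOn (H.strongConvexOn_fhat hy z₁) hx₁ h₁ hx₂
  have a2 := StrongConvexOn.add_le_of_isMinOn (H.strongConvexOn_fhat hy z₂) hx₂ h₂ hx₁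
  simp only [fhat] at a1 a2
  rw [norm_sub_rev x₂ x₁] at a1
  -- Adding the two growth inequalities cancels `f̃`; only the proximal terms remain, and the
  -- constant is `p / l = 2`.
  have e : ‖x₂ - z₁‖ ^ 2 - ‖x₂ - z₂‖ ^ 2 + ‖x₁ - z₂‖ ^ 2 - ‖x₁ - z₁‖ ^ 2 =
      2 * inner ℝ (x₁ - x₂) (z₁ - z₂) := by
    simp only [norm_sub_sq_real, inner_sub_left, inner_sub_right]; ring
  have h3 := real_inner_le_norm (x₁ - x₂) (z₁ - z₂)
  have h4 : l * ‖x₁ - x₂‖ ^ 2 ≤ l * (2 * (‖x₁ - x₂‖ * ‖z₁ - z₂‖)) := by nlinarith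
  have h5 := le_of_mul_le_mul_left h4 hl
  rcases (norm_nonneg (x₁ - x₂)).eq_or_lt with h | h
  · rw [← h]; positivity
  · exact le_of_mul_le_mul_left (by linarith) h

/-- The minimizer of `f̂(·, y; z)` is `1`-Lipschitz in `y`. -/
theorem norm_argmin_sub_le_dual (H : P.SaddleAssumption ζ μ l) {y₁ y₂ : YSpace d₂} (hy₁ : y₁ ∈ P.Y)
    (hy₂ : y₂ ∈ P.Y) {z x₁ x₂ : XSpace d₁ r} (hx₁ : x₁ ∈ P.X) (hx₂ : x₂ ∈ P.X)
    (h₁ : IsMinOn (fun x => P.fhat (2 * l) x y₁ z) P.X x₁)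
    (h₂ : IsMinOn (fun x => P.fhat (2 * l) x y₂ z) P.X x₂) :
    ‖x₁ - x₂‖ ≤ ‖y₁ - y₂‖ := by
  have hl := H.const.1
  have a1 := StrongConvexOn.add_le_of_isMinOn (H.strongConvexOn_fhat hy₁ z) hx₁ h₁ hx₂
  have a2 := StrongConvexOn.add_le_of_isMinOn (H.strongConvexOn_fhat hy₂ z) hx₂ h₂ hx₁
  simp only [fhat] at a1 a2
  rw [norm_sub_rev x₂ x₁] at a1
  -- Now the proximal terms cancel, and the remaining difference `f̃(·, y₁) - f̃(·, y₂)` is `l‖y₁ -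
  -- y₂‖`-Lipschitz in `x`.
  have h3 := convex_X.norm_image_sub_le_of_norm_hasFDerivWithin_le (C := l * ‖y₁ - y₂‖)
    (f := fun x => P.ft x y₁ - P.ft x y₂)
    (fun x hx => ((H.smooth.hasGradientAt_ft_left hx hy₁).hasFDerivAt.sub
      (H.smooth.hasGradientAt_ft_left hx hy₂).hasFDerivAt).hasFDerivWithinAt)
    (fun x hx => by
      rw [← map_sub, LinearIsometryEquiv.norm_map]
      simpa using (H.const.2 x hx x hx y₁ hy₁ y₂ hy₂).1) hx₁ hx₂
  have h4 := (le_abs_self _).trans h3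
  rw [norm_sub_rev x₂ x₁] at h4
  have h5 : l * (‖x₁ - x₂‖ * ‖x₁ - x₂‖) ≤ l * (‖x₁ - x₂‖ * ‖y₁ - y₂‖) := by nlinarith
  have h6 := le_of_mul_le_mul_left h5 hl
  rcases (norm_nonneg (x₁ - x₂)).eq_or_lt with h | h
  · rw [← h]; positivity
  · exact le_of_mul_le_mul_left h6 h

/-- Quadratic lower bound for `Ψ` along the gradient at the inner minimizer. -/
theorem Psi_add_le (H : P.SaddleAssumption ζ μ l) {y y' : YSpace d₂} (hy : y ∈ P.Y)
    (hy' : y' ∈ P.Y) {z u : XSpace d₁ r} (hu : u ∈ P.X)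
    (hmin : IsMinOn (fun x => P.fhat (2 * l) x y z) P.X u) :
    P.fhat (2 * l) u y z + inner ℝ (P.ftGradY u y) (y' - y) - l * ‖y' - y‖ ^ 2 ≤
      P.Psi (2 * l) y' z := by
  have hl := H.const.1
  obtain ⟨u', hu', -, e⟩ := H.exists_argmin_fhat hy' (2 * l) z
  have h1 := StrongConvexOn.add_le_of_isMinOn (H.strongConvexOn_fhat hy z) hu hmin hu'
  have h2 := H.le_ft_right hu' hy hy'
  have h3 := (H.const.2 u' hu' u hu y hy y hy).2
  have h4 : inner ℝ (P.ftGradY u y) (y' - y) - inner ℝ (P.ftGradY u' y) (y' - y) ≤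
      ‖P.ftGradY u' y - P.ftGradY u y‖ * ‖y' - y‖ := by
    rw [← inner_sub_left, norm_sub_rev]; exact real_inner_le_norm _ _
  simp only [sub_self, norm_zero, mul_zero, add_zero] at h3
  have h5 := mul_le_mul_of_nonneg_right h3 (norm_nonneg (y' - y))
  rw [e]
  simp only [fhat] at h1 ⊢
  -- The growth `(l/2)‖u' - u‖²` absorbs the cross term `l‖u' - u‖‖y' - y‖` at the cost of a further
  -- `(l/2)‖y' - y‖²`.
  nlinarith [mul_nonneg hl.le (sq_nonneg (‖u' - u‖ - ‖y' - y‖))]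

/-- Distance of the inner minimizer at `(y, z)` to the minimizer of `Φ(·; z)`, in terms of any dual
subgradient: the consequence of the PL inequality that drives the analysis. -/
theorem norm_argmin_sub_argmin_Phi_sq_le (H : P.SaddleAssumption ζ μ l) {y : YSpace d₂}
    (hy : y ∈ P.Y) {z u xs : XSpace d₁ r} (hu : u ∈ P.X)
    (hPsi : P.Psi (2 * l) y z = P.fhat (2 * l) u y z)
    (hxs : xs ∈ P.X) (hmin : IsMinOn (fun x => P.Phi (2 * l) x z) P.X xs)
    (hP : P.Pval (2 * l) z = P.Phi (2 * l) xs z) {v : YSpace d₂}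
    (hv : v ∈ frechetSubdiff P.h y) :
    l * ‖u - xs‖ ^ 2 ≤ 1 / μ * ‖v - P.ftGradY u y‖ ^ 2 := by
  have h1 := StrongConvexOn.add_le_of_isMinOn (H.strongConvexOn_Phi z) hxs hmin hu
  have h2 := H.Phi_sub_fhatr_le (p := 2 * l) hu hy z hv
  have h3 := H.Psir_le_Pval (p := 2 * l) hy z
  rw [Psir, hPsi, hP] at h3
  simp only [fhatr] at h2
  have h4 : 1 / (2 * μ) * ‖v - P.ftGradY u y‖ ^ 2 = 1 / μ * ‖v - P.ftGradY u y‖ ^ 2 / 2 := by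
    have := H.pl.mu_pos
    field_simp
  linarith

end ErrorBounds

/-! ### The projected gradient step -/

section PrimalStep

/-- A projected gradient step for `f̂(·, y; z)`. -/
theorem primal_step_descent (H : P.SaddleAssumption ζ μ l) {τ : ℝ} (hτ : 0 < τ)
    (hτl : 3 * l ≤ 1 / τ) {y : YSpace d₂} (hy : y ∈ P.Y) {x x' z : XSpace d₁ r} (hx : x ∈ P.X)
    (hx' : x' ∈ P.X)
    (hvi : ∀ w ∈ P.X,
      inner ℝ (x - τ • (P.ftGradX x y + (2 * l) • (x - z)) - x') (w - x') ≤ 0)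
    {w : XSpace d₁ r} (hw : w ∈ P.X) :
    P.fhat (2 * l) x' y z + 1 / τ / 2 * ‖w - x'‖ ^ 2 ≤
      P.fhat (2 * l) w y z + (1 / τ - l) / 2 * ‖w - x‖ ^ 2 := by
  have h := projected_gradient_three_point (φ := fun x => P.fhat (2 * l) x y z) hτ
    (fun w hw => H.le_fhat hy hx hw z) (H.fhat_le hy hx hx' z) hvi hw
  have e : 1 / (2 * τ) = 1 / τ / 2 := by field_simp
  rw [e] at h
  have : 0 ≤ (1 / τ / 2 - 3 * l / 2) * ‖x' - x‖ ^ 2 := mul_nonneg (by linarith) (sq_nonneg _)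
  linarith

/-- The step length of a projected gradient step controls the distance to the minimizer. -/
theorem norm_step_sub_argmin_le (H : P.SaddleAssumption ζ μ l) {τ : ℝ} (hτ : 0 < τ)
    (hτl : 3 * l ≤ 1 / τ) {y : YSpace d₂} (hy : y ∈ P.Y) {x x' z u : XSpace d₁ r} (hx : x ∈ P.X)
    (hx' : x' ∈ P.X)
    (hvi : ∀ w ∈ P.X,
      inner ℝ (x - τ • (P.ftGradX x y + (2 * l) • (x - z)) - x') (w - x') ≤ 0)
    (hu : u ∈ P.X) (hmin : IsMinOn (fun x => P.fhat (2 * l) x y z) P.X u) :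
    l * ‖x' - u‖ ≤ 3 / 2 * (1 / τ) * ‖x' - x‖ := by
  have hl := H.const.1
  have h1 := H.primal_step_descent hτ hτl hy hx hx' hvi hu
  have h2 := StrongConvexOn.add_le_of_isMinOn (H.strongConvexOn_fhat hy z) hu hmin hx'
  have h3 : ‖u - x‖ ≤ ‖x' - u‖ + ‖x' - x‖ := by
    rw [norm_sub_rev x' u]; exact norm_sub_le_norm_sub_add_norm_sub _ _ _
  rw [norm_sub_rev u x'] at h1
  set n := 1 / τ
  have he := norm_nonneg (x' - u)
  have hs := norm_nonneg (x' - x)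
  set e := ‖x' - u‖
  set s := ‖x' - x‖
  have h4 : ‖u - x‖ ^ 2 ≤ (e + s) ^ 2 := by gcongr
  have h5 : (n + l) * e ^ 2 ≤ (n - l) * (e + s) ^ 2 := by nlinarith
  -- If the bound fails, `3l ≤ 1/τ` forces `9s/2 ≤ e`; then `2le² ≤ ns(2e + s) ≤ (20/9)nse`, so `le
  -- ≤ (10/9)ns`, a contradiction.
  by_contra! hcon
  have hpos : 0 < e := by
    rcases he.eq_or_lt with h | h
    · rw [← h, mul_zero] at hcon
      have : 0 ≤ 3 / 2 * n * s := by positivity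
      linarith
    · exact h
  have h6 : 2 * l * e ^ 2 ≤ n * (2 * e * s + s ^ 2) := by nlinarith [mul_nonneg he hs]
  have h7 : 9 / 2 * s ≤ e := by
    by_contra! h
    nlinarith
  nlinarith [mul_pos hpos (sub_pos.2 hcon), mul_nonneg hs (sub_nonneg.2 h7)]

end PrimalStep

end SaddleAssumption

end Problem

end SmMGDA

/-! ### Decrease of the potential -/

namespace SmMGDA

namespace Problem

variable {d₁ r d₂ : ℕ} {P : Problem d₁ r d₂} {ζ μ l : ℝ}

/-- The Lyapunov function `f̂_r(x, y; z) - 2 Ψ_r(y; z) + 2 P(z)`. -/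
noncomputable def potential (P : Problem d₁ r d₂) (p : ℝ) (x : XSpace d₁ r) (y : YSpace d₂)
    (z : XSpace d₁ r) : ℝ :=
  P.fhatr p x y z - 2 * P.Psir p y z + 2 * P.Pval p z

namespace SaddleAssumption

theorem Fbar_le_potential (H : P.SaddleAssumption ζ μ l) {x : XSpace d₁ r} (hx : x ∈ P.X)
    {y : YSpace d₂} (hy : y ∈ P.Y) (z : XSpace d₁ r) : P.Fbar ≤ P.potential (2 * l) x y z := by
  have h1 := H.Psir_le_fhatr (p := 2 * l) hy hx z
  have h2 := H.Psir_le_Pval (p := 2 * l) hy z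
  have h3 := H.Fbar_le_Pval (p := 2 * l) (by linarith [H.const.1]) z
  rw [potential]; linarith

/-- Change of the potential in the dual step. -/
theorem dual_step_potential (H : P.SaddleAssumption ζ μ l) {τ : ℝ} (hτ : 0 < τ)
    {x' z u : XSpace d₁ r} {y y' : YSpace d₂} (hx' : x' ∈ P.X) (hy : y ∈ P.Y) (hy' : y' ∈ P.Y)
    (hprox : y' = prox τ P.h (y + τ • P.ftGradY x' y)) (hu : u ∈ P.X)
    (hmin : IsMinOn (fun x => P.fhat (2 * l) x y z) P.X u)
    (hPsi : P.Psi (2 * l) y z = P.fhat (2 * l) u y z) :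
    P.potential (2 * l) x' y' z + (1 / τ - ζ / 2 - 5 / 2 * l) * ‖y' - y‖ ^ 2 -
      2 * (l * ‖x' - u‖ * ‖y' - y‖) ≤ P.potential (2 * l) x' y z := by
  have h1 := prox_step_descent H.reg.proper H.reg.isCompact_Y H.reg.continuousOn_h
    H.reg.weaklyConvex hτ hy (P.ftGradY x' y)
  rw [← hprox] at h1
  have h2 := H.Psi_add_le hy hy' hu hmin
  have h3 := H.ft_right_le hx' hy hy'
  have h4 := (H.const.2 x' hx' u hu y hy y hy).2
  simp only [sub_self, norm_zero, mul_zero, add_zero] at h4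
  have h5 : inner ℝ (P.ftGradY x' y) (y' - y) - inner ℝ (P.ftGradY u y) (y' - y) ≤
      l * ‖x' - u‖ * ‖y' - y‖ := by
    rw [← inner_sub_left]
    exact (real_inner_le_norm _ _).trans (mul_le_mul_of_nonneg_right h4 (norm_nonneg _))
  rw [← hPsi] at h2
  simp only [potential, fhatr, fhat, Psir]
  linarith

/-- Change of the potential in the averaging step. -/
theorem center_step_potential (H : P.SaddleAssumption ζ μ l) {β : ℝ} (hβ : 0 ≤ β)
    {x' z z' u xs : XSpace d₁ r} {y : YSpace d₂} (hy : y ∈ P.Y)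
    (hz : z' = z + β • (x' - z)) (hu : u ∈ P.X)
    (hmin : IsMinOn (fun x => P.fhat (2 * l) x y z) P.X u)
    (hxs : xs ∈ P.X) (hP : P.Pval (2 * l) z = P.Phi (2 * l) xs z) :
    P.potential (2 * l) x' y z' + l * β * (1 - 9 * β) * ‖x' - z‖ ^ 2 -
      4 * β * (l * ‖u - xs‖ ^ 2) ≤ P.potential (2 * l) x' y z := by
  have hl := H.const.1
  obtain ⟨u', hu', hmin', hPsi'⟩ := H.exists_argmin_fhat hy (2 * l) z'
  have h1 := H.Psi_le_fhat (p := 2 * l) hy hu' z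
  have h2 := H.Pval_le_Phi (p := 2 * l) hxs z'
  rw [H.Phi_eq hxs] at h2 hP
  have h3 := H.norm_argmin_sub_le_center hy hu hu' hmin hmin'
  have h4 : ‖z - z'‖ = β * ‖x' - z‖ := by
    rw [hz, sub_add_cancel_left, norm_neg, norm_smul, Real.norm_of_nonneg hβ]
  have hexp : ∀ a : XSpace d₁ r, ‖a - z'‖ ^ 2 =
      ‖a - z‖ ^ 2 - 2 * β * inner ℝ (a - z) (x' - z) + β ^ 2 * ‖x' - z‖ ^ 2 := by
    intro a
    rw [hz, show a - (z + β • (x' - z)) = (a - z) - β • (x' - z) by abel, norm_sub_sq_real,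
      real_inner_smul_right, norm_smul, Real.norm_of_nonneg hβ]
    ring
  have h5 : inner ℝ (u' - z) (x' - z) - inner ℝ (xs - z) (x' - z) ≤
      (‖u - xs‖ + 2 * (β * ‖x' - z‖)) * ‖x' - z‖ := by
    rw [← inner_sub_left]
    refine (real_inner_le_norm _ _).trans (mul_le_mul_of_nonneg_right ?_ (norm_nonneg _))
    rw [show u' - z - (xs - z) = (u - xs) - (u - u') by abel]
    refine (norm_sub_le _ _).trans ?_
    rw [h4] at h3
    linarith
  have h6 := real_inner_self_eq_norm_sq (x' - z)
  simp only [potential, fhatr, fhat, Psir, hPsi'] at h1 ⊢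
  rw [hexp] at h2 ⊢
  rw [hexp u', h6]
  have hlβ : 0 ≤ l * β := mul_nonneg hl.le hβ
  have h7 := mul_le_mul_of_nonneg_left h5 hlβ
  -- Young's inequality `4Dw ≤ w² + 4D²` spends half of the gain `2lβw²` and produces the error
  -- `4βlD²`.
  have h8 := mul_nonneg hlβ (sq_nonneg (‖x' - z‖ - 2 * ‖u - xs‖))
  linarith

/-- The arithmetic behind the one-step decrease of the potential. -/
theorem descent_arith {n k s q w e D v α β V₀ V₁ V₂ V₃ : ℝ} (hl : 0 < l) (hμ : 0 < μ) (hζ : 0 ≤ ζ)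
    (hn : 3 * l ≤ n) (hk : k = 16 * (3 * n + ζ)) (hα : 0 < α) (hα' : α < 1 / 2306)
    (hβ : β = α * min μ l * (1 / k)) (hq : 0 ≤ q) (hv : 0 ≤ v)
    (h₁ : V₁ + n / 2 * s ^ 2 ≤ V₀)
    (h₂ : V₂ + (k - ζ / 2 - 5 / 2 * l) * q ^ 2 - 2 * (l * e * q) ≤ V₁)
    (h₃ : V₃ + l * β * (1 - 9 * β) * w ^ 2 - 4 * β * (l * D ^ 2) ≤ V₂)
    (hle : l * e ≤ 3 / 2 * n * s) (hD : l * D ^ 2 ≤ 1 / μ * v ^ 2)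
    (hvb : v ≤ (k + 2 * l) * q + l * e) :
    V₃ + n / 8 * s ^ 2 + k / 2 * q ^ 2 + l * β / 2 * w ^ 2 ≤ V₀ := by
  have hn0 : 0 < n := by linarith
  have hk0 : 0 < k := by rw [hk]; positivity
  have hnk : n ≤ k / 48 := by linarith
  have hζk : ζ ≤ k / 16 := by linarith
  have hlk : l ≤ k / 144 := by linarith
  have hmin : 0 < min μ l := lt_min hμ hl
  have hβ0 : 0 < β := by rw [hβ]; positivity
  -- The factor `min μ l` in `β` cancels the `1/μ` of the PL bound, and `1/k = τ₂` cancels one power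
  -- of `k` in `v²`.
  have hβμ : β * (1 / μ) ≤ α * (1 / k) := by
    rw [hβ, mul_one_div, div_le_iff₀ hμ]
    have : α * (1 / k) * min μ l ≤ α * (1 / k) * μ :=
      mul_le_mul_of_nonneg_left (min_le_left _ _) (by positivity)
    linarith
  have hβ1 : β ≤ 1 / 18 := by
    have h1 : min μ l * (1 / k) ≤ 1 := by
      rw [mul_one_div, div_le_one hk0]
      linarith [min_le_right μ l]
    have h2 : α * (min μ l * (1 / k)) ≤ α * 1 := mul_le_mul_of_nonneg_left h1 hα.le
    rw [hβ]; linarith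
  have hcross : 2 * (l * e * q) ≤ n / 4 * s ^ 2 + 9 * n * q ^ 2 := by
    have h1 := mul_le_mul_of_nonneg_right hle hq
    have h2 := mul_nonneg hn0.le (sq_nonneg (s / 2 - 3 * q))
    linarith
  have hv' : v ≤ 73 / 72 * (k * q) + 3 / 2 * (n * s) := by
    have := mul_le_mul_of_nonneg_right hlk hq
    linarith
  -- From `(a + b)² ≤ 2a² + 2b²`: `2(73/72)² < 2.06`, and `2(3/2)²/48 < 0.1` using `n ≤ k/48`.
  have hv2 : v ^ 2 ≤ k * (2.06 * (k * q ^ 2) + 0.1 * (n * s ^ 2)) := by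
    have h1 : v ^ 2 ≤ (73 / 72 * (k * q) + 3 / 2 * (n * s)) ^ 2 := by gcongr
    have h2 := sq_nonneg (73 / 72 * (k * q) - 3 / 2 * (n * s))
    have h3 : n * (n * s ^ 2) ≤ k / 48 * (n * s ^ 2) :=
      mul_le_mul_of_nonneg_right hnk (by positivity)
    have h4 : 0 ≤ k ^ 2 * q ^ 2 := by positivity
    have h5 : 0 ≤ k * (n * s ^ 2) := by positivity
    nlinarith
  have hgap : 4 * β * (l * D ^ 2) ≤ k / 100 * q ^ 2 + n / 1000 * s ^ 2 := by
    have h1 : β * (l * D ^ 2) ≤ β * (1 / μ) * v ^ 2 := by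
      rw [mul_assoc]; exact mul_le_mul_of_nonneg_left hD hβ0.le
    have h2 : β * (1 / μ) * v ^ 2 ≤ α * (1 / k) * v ^ 2 :=
      mul_le_mul_of_nonneg_right hβμ (sq_nonneg _)
    have h3 : α * (1 / k) * v ^ 2 ≤ α * (2.06 * (k * q ^ 2) + 0.1 * (n * s ^ 2)) := by
      rw [mul_assoc]
      refine mul_le_mul_of_nonneg_left ?_ hα.le
      rw [one_div, inv_mul_le_iff₀ hk0]
      exact hv2
    have h4 : α * (2.06 * (k * q ^ 2) + 0.1 * (n * s ^ 2)) ≤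
        1 / 2306 * (2.06 * (k * q ^ 2) + 0.1 * (n * s ^ 2)) :=
      mul_le_mul_of_nonneg_right hα'.le (by positivity)
    have h5 : 0 ≤ k * q ^ 2 := by positivity
    have h6 : 0 ≤ n * s ^ 2 := by positivity
    linarith
  have hw : l * β / 2 * w ^ 2 ≤ l * β * (1 - 9 * β) * w ^ 2 := by
    have : 0 ≤ l * β * w ^ 2 * (1 / 2 - 9 * β) :=
      mul_nonneg (by positivity) (by linarith)
    linarith
  have hqq : k / 2 * q ^ 2 + k / 100 * q ^ 2 + 9 * n * q ^ 2 ≤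
      (k - ζ / 2 - 5 / 2 * l) * q ^ 2 := by
    rw [← add_mul, ← add_mul]
    exact mul_le_mul_of_nonneg_right (by linarith) (sq_nonneg _)
  have h6 : 0 ≤ n * s ^ 2 := by positivity
  linarith

/-- One iteration decreases the potential. -/
theorem step_potential (H : P.SaddleAssumption ζ μ l) {τ₁ τ₂ α β : ℝ} (hτ₁ : 0 < τ₁)
    (hτl : 3 * l ≤ 1 / τ₁) (hτ₂ : 0 < τ₂) (hk : 1 / τ₂ = 16 * (3 * (1 / τ₁) + ζ)) (hα : 0 < α)
    (hα' : α < 1 / 2306) (hβ : β = α * min μ l * τ₂)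
    {x x' z z' : XSpace d₁ r} {y y' : YSpace d₂} (hx : x ∈ P.X) (hx' : x' ∈ P.X) (hy : y ∈ P.Y)
    (hy' : y' ∈ P.Y)
    (hvi : ∀ w ∈ P.X,
      inner ℝ (x - τ₁ • (P.ftGradX x y + (2 * l) • (x - z)) - x') (w - x') ≤ 0)
    (hprox : y' = prox τ₂ P.h (y + τ₂ • P.ftGradY x' y)) (hz : z' = z + β • (x' - z)) :
    P.potential (2 * l) x' y' z' + 1 / τ₁ / 8 * ‖x' - x‖ ^ 2 + 1 / τ₂ / 2 * ‖y' - y‖ ^ 2 +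
      l * β / 2 * ‖x' - z‖ ^ 2 ≤ P.potential (2 * l) x y z := by
  have hl := H.const.1
  have hμ := H.pl.mu_pos
  have hβ0 : 0 ≤ β := by
    have : 0 < min μ l := lt_min hμ hl
    rw [hβ]; positivity
  obtain ⟨u, hu, hmin, hPsi⟩ := H.exists_argmin_fhat hy (2 * l) z
  obtain ⟨u', hu', hmin', hPsi'⟩ := H.exists_argmin_fhat hy' (2 * l) z
  obtain ⟨xs, hxs, hmins, hPs⟩ := H.exists_argmin_Phi (2 * l) z
  -- The proximal optimality condition supplies the subgradient at the new `y'`. The PL bound is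
  -- used there, at the inner minimizer `u'` for `(y', z)`, since averaging follows the dual step.
  have hsub := prox_mem_frechetSubdiff H.reg.proper H.reg.isCompact_Y H.reg.continuousOn_h hτ₂
    (y + τ₂ • P.ftGradY x' y)
  rw [← hprox] at hsub
  have hdual := H.norm_argmin_sub_le_dual hy hy' hu hu' hmin hmin'
  have hgrad := (H.const.2 x' hx' u' hu' y hy y' hy').2
  refine descent_arith (e := ‖x' - u‖) (D := ‖u' - xs‖)
    (v := ‖(1 / τ₂) • (y + τ₂ • P.ftGradY x' y - y') - P.ftGradY u' y'‖)
    (V₁ := P.potential (2 * l) x' y z) (V₂ := P.potential (2 * l) x' y' z)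
    hl hμ H.reg.zeta_nonneg hτl hk hα hα' (by rw [hβ, one_div_one_div]) (norm_nonneg _)
    (norm_nonneg _) ?_
    (H.dual_step_potential hτ₂ hx' hy hy' hprox hu hmin hPsi)
    (H.center_step_potential hβ0 hy' hz hu' hmin' hxs hPs)
    (H.norm_step_sub_argmin_le hτ₁ hτl hy hx hx' hvi hu hmin)
    (H.norm_argmin_sub_argmin_Phi_sq_le hy' hu' hPsi' hxs hmins hPs hsub) ?_
  · have := H.primal_step_descent hτ₁ hτl hy hx hx' hvi hx
    rw [sub_self, norm_zero, norm_sub_rev x x'] at this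
    simp only [potential, fhatr]
    linarith
  · have e : (1 / τ₂) • (y + τ₂ • P.ftGradY x' y - y') - P.ftGradY u' y' =
        (1 / τ₂) • (y - y') + (P.ftGradY x' y - P.ftGradY u' y') := by
      rw [add_sub_right_comm, smul_add, smul_smul, one_div_mul_cancel hτ₂.ne', one_smul]
      abel
    have h1 : ‖x' - u'‖ ≤ ‖x' - u‖ + ‖u - u'‖ := norm_sub_le_norm_sub_add_norm_sub _ _ _
    rw [e]
    refine (norm_add_le _ _).trans ?_
    rw [norm_smul, Real.norm_of_nonneg (by positivity : 0 ≤ 1 / τ₂), norm_sub_rev y' y]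
    have h2 := mul_le_mul_of_nonneg_left (h1.trans (add_le_add_right hdual _)) hl.le
    linarith

end SaddleAssumption

end Problem

end SmMGDA

/-! ### Residuals of one iteration -/

namespace SmMGDA

namespace Problem

variable {d₁ r d₂ : ℕ} {P : Problem d₁ r d₂} {ζ μ l : ℝ}

namespace SaddleAssumption

theorem step_x_mem (H : P.SaddleAssumption ζ μ l) (τ₁ τ₂ θ p β : ℝ) (s : Iterate d₁ r d₂) :
    (P.step τ₁ τ₂ θ p β s).x ∈ P.X :=
  (proj_spec isCompact_X.isClosed (nonempty_X H.C_pos) _).1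

theorem step_y_mem (H : P.SaddleAssumption ζ μ l) {τ₂ : ℝ} (hτ₂ : 0 < τ₂) (τ₁ θ p β : ℝ)
    (s : Iterate d₁ r d₂) : (P.step τ₁ τ₂ θ p β s).y ∈ P.Y :=
  (prox_spec H.reg.proper H.reg.isCompact_Y H.reg.continuousOn_h hτ₂ _).1

theorem step_y_eq (τ₁ τ₂ p β : ℝ) (s : Iterate d₁ r d₂) :
    (P.step τ₁ τ₂ 0 p β s).y =
      prox τ₂ P.h (s.y + τ₂ • P.ftGradY (P.step τ₁ τ₂ 0 p β s).x s.y) := by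
  simp only [step, zero_smul, sub_zero, ftGradY_eq]

/-- The variational inequality characterizing the projected gradient step. -/
theorem step_x_variational (H : P.SaddleAssumption ζ μ l) (τ₁ τ₂ θ p β : ℝ)
    {s : Iterate d₁ r d₂} (hx : s.x ∈ P.X) (hy : s.y ∈ P.Y) {w : XSpace d₁ r} (hw : w ∈ P.X) :
    inner ℝ (s.x - τ₁ • (P.ftGradX s.x s.y + p • (s.x - s.z)) - (P.step τ₁ τ₂ θ p β s).x)
      (w - (P.step τ₁ τ₂ θ p β s).x) ≤ 0 := by
  rw [H.smooth.ftGradX_eq hx hy]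
  exact inner_sub_proj_le_zero isCompact_X.isClosed convex_X (nonempty_X H.C_pos) _ hw

/-- The projection residual divided by `τ₁` is normal to `X` at the new point; adding the gradient
there gives exactly `G^x`. -/
theorem stepGx_mem_xSubdiff (H : P.SaddleAssumption ζ μ l) {τ₁ : ℝ} (hτ₁ : 0 < τ₁)
    (τ₂ θ p β : ℝ) {s : Iterate d₁ r d₂} (hx : s.x ∈ P.X) (hy : s.y ∈ P.Y) :
    P.stepGx τ₁ p s (P.step τ₁ τ₂ θ p β s) ∈
      P.xSubdiff (P.step τ₁ τ₂ θ p β s).x (P.step τ₁ τ₂ θ p β s).y := by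
  set s' := P.step τ₁ τ₂ θ p β s with hs'
  refine ⟨(1 / τ₁) • (s.x - τ₁ • (P.ftGradX s.x s.y + p • (s.x - s.z)) - s'.x), ?_, ?_⟩
  · refine mem_frechetSubdiff_indicatorFun (H.step_x_mem _ _ _ _ _ _) fun w hw => ?_
    rw [real_inner_smul_left]
    exact mul_nonpos_of_nonneg_of_nonpos (by positivity)
      (H.step_x_variational τ₁ τ₂ θ p β hx hy hw)
  · simp only [stepGx, smul_sub, smul_smul, smul_add, one_div_mul_cancel hτ₁.ne', one_smul]
    rw [← mul_assoc, one_div_mul_cancel hτ₁.ne', one_mul]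
    abel

theorem stepGy_mem (H : P.SaddleAssumption ζ μ l) {τ₂ : ℝ} (hτ₂ : 0 < τ₂)
    (τ₁ p β : ℝ) (s : Iterate d₁ r d₂) :
    P.stepGy τ₂ s (P.step τ₁ τ₂ 0 p β s) ∈
      (fun g => P.ftGradY (P.step τ₁ τ₂ 0 p β s).x (P.step τ₁ τ₂ 0 p β s).y - g) ''
        frechetSubdiff P.h (P.step τ₁ τ₂ 0 p β s).y := by
  have h := prox_mem_frechetSubdiff H.reg.proper H.reg.isCompact_Y H.reg.continuousOn_h hτ₂
    (s.y + τ₂ • P.ftGradY (P.step τ₁ τ₂ 0 p β s).x s.y)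
  rw [← step_y_eq] at h
  set s' := P.step τ₁ τ₂ 0 p β s
  refine ⟨_, h, ?_⟩
  simp only [stepGy, smul_sub, smul_add, smul_smul, one_div_mul_cancel hτ₂.ne', one_smul]
  abel

theorem norm_stepGx_le (H : P.SaddleAssumption ζ μ l) {τ₁ : ℝ} (hτ₁ : 0 < τ₁)
    (hτl : 3 * l ≤ 1 / τ₁) {s s' : Iterate d₁ r d₂} (hx : s.x ∈ P.X) (hy : s.y ∈ P.Y)
    (hx' : s'.x ∈ P.X) (hy' : s'.y ∈ P.Y) :
    ‖P.stepGx τ₁ (2 * l) s s'‖ ≤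
      2 * (1 / τ₁) * ‖s'.x - s.x‖ + l * ‖s'.y - s.y‖ + 2 * l * ‖s'.x - s.z‖ := by
  have hl := H.const.1
  have h1 := (H.const.2 _ hx' _ hx _ hy' _ hy).1
  have e : P.stepGx τ₁ (2 * l) s s' = (1 / τ₁) • (s.x - s'.x) +
      (P.ftGradX s'.x s'.y - P.ftGradX s.x s.y) + (2 * l) • (s.z - s.x) := by
    rw [stepGx]; abel
  have h2 : ‖s.z - s.x‖ ≤ ‖s'.x - s.z‖ + ‖s'.x - s.x‖ := by
    rw [norm_sub_rev s'.x s.z]; exact norm_sub_le_norm_sub_add_norm_sub _ _ _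
  rw [e]
  refine norm_add₃_le.trans ?_
  rw [norm_smul, norm_smul, Real.norm_of_nonneg (by positivity : 0 ≤ 1 / τ₁),
    Real.norm_of_nonneg (by positivity : 0 ≤ 2 * l), norm_sub_rev s.x]
  have h3 := mul_le_mul_of_nonneg_left h2 (by positivity : 0 ≤ 2 * l)
  have h4 := mul_le_mul_of_nonneg_right hτl (norm_nonneg (s'.x - s.x))
  linarith

theorem norm_stepGy_le (H : P.SaddleAssumption ζ μ l) {τ₂ : ℝ} (hτ₂ : 0 < τ₂)
    {s s' : Iterate d₁ r d₂} (hy : s.y ∈ P.Y) (hx' : s'.x ∈ P.X) (hy' : s'.y ∈ P.Y) :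
    ‖P.stepGy τ₂ s s'‖ ≤ (1 / τ₂ + l) * ‖s'.y - s.y‖ := by
  have h1 := (H.const.2 _ hx' _ hx' _ hy' _ hy).2
  simp only [sub_self, norm_zero, mul_zero, zero_add] at h1
  rw [stepGy, add_sub_assoc]
  refine (norm_add_le _ _).trans ?_
  rw [norm_smul, Real.norm_of_nonneg (by positivity : 0 ≤ 1 / τ₂)]
  linarith

/-- The arithmetic bounding the stationarity measure by the decrease `D` of the potential. -/
theorem stationarity_arith {n k s q w D α β κ a b : ℝ} (hl : 0 < l) (hμ : 0 < μ) (hζ : 0 ≤ ζ)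
    (hn : 3 * l ≤ n) (hk : k = 16 * (3 * n + ζ)) (hα : 0 < α) (hα' : α < 1 / 2306)
    (hβ : β = α * min μ l * (1 / k)) (hκ : κ = max 1 (l / μ))
    (ha0 : 0 ≤ a) (hb0 : 0 ≤ b)
    (ha : a ≤ 2 * n * s + l * q + 2 * l * w) (hb : b ≤ (k + l) * q)
    (hD : n / 8 * s ^ 2 + k / 2 * q ^ 2 + l * β / 2 * w ^ 2 ≤ D) :
    a ^ 2 + κ * b ^ 2 ≤ 1920 / α * κ * (n + ζ) * D := by
  have hn0 : 0 < n := by linarith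
  have hk0 : 0 < k := by rw [hk]; positivity
  have hmin : 0 < min μ l := lt_min hμ hl
  have hβ0 : 0 < β := by rw [hβ]; positivity
  have hκ1 : 1 ≤ κ := by rw [hκ]; exact le_max_left _ _
  -- This identity converts the weight `β` on `w²` into the factor `R = κk/α`.
  have hκmin : κ * min μ l = l := by
    rw [hκ]
    rcases le_total μ l with h | h
    · rw [min_eq_left h, max_eq_right ((one_le_div hμ).2 h), div_mul_cancel₀ _ hμ.ne']
    · rw [min_eq_right h, max_eq_left ((div_le_one hμ).2 h), one_mul]
  have hβκ : κ * k / α * β = l := by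
    rw [hβ]
    calc κ * k / α * (α * min μ l * (1 / k)) = κ * min μ l := by field_simp
      _ = l := hκmin
  have hα1 : 1 ≤ 1 / α := (one_le_div hα).2 (by linarith)
  have hs0 : 0 ≤ n * s ^ 2 := by positivity
  have hq0 : 0 ≤ k * q ^ 2 := by positivity
  have hw0 : 0 ≤ l * β * w ^ 2 := by positivity
  have hD0 : 0 ≤ D := by linarith
  set R := κ * k / α with hR
  have hkR : κ * k ≤ R := by
    rw [hR, div_eq_mul_one_div]
    exact le_mul_of_one_le_right (by positivity) hα1
  have hkκ : k ≤ κ * k := le_mul_of_one_le_left hk0.le hκ1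
  have h1 : n * (n * s ^ 2) ≤ n * (8 * D) := mul_le_mul_of_nonneg_left (by linarith) hn0.le
  have h2 : l ^ 2 * q ^ 2 ≤ k * (2 * D) := by
    have : l ^ 2 * q ^ 2 ≤ k ^ 2 * q ^ 2 := by gcongr; linarith
    have : k * (k * q ^ 2) ≤ k * (2 * D) := mul_le_mul_of_nonneg_left (by linarith) hk0.le
    linarith
  have h3 : l ^ 2 * w ^ 2 ≤ R * (2 * D) := by
    have : R * (l * β * w ^ 2) ≤ R * (2 * D) :=
      mul_le_mul_of_nonneg_left (by linarith) (by positivity)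
    calc l ^ 2 * w ^ 2 = R * β * l * w ^ 2 := by rw [hβκ]; ring
      _ ≤ R * (2 * D) := by linarith
  have h4 : b ^ 2 ≤ 8 * (k * D) := by
    have h5 : b ^ 2 ≤ ((k + l) * q) ^ 2 := by gcongr
    have h6 : ((k + l) * q) ^ 2 ≤ (2 * k) ^ 2 * q ^ 2 := by
      rw [mul_pow]; gcongr; linarith
    have h7 : k * (k * q ^ 2) ≤ k * (2 * D) := mul_le_mul_of_nonneg_left (by linarith) hk0.le
    linarith
  have h5 : a ^ 2 ≤ 3 * (4 * (n * (n * s ^ 2)) + l ^ 2 * q ^ 2 + 4 * (l ^ 2 * w ^ 2)) := by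
    have h6 : a ^ 2 ≤ (2 * n * s + l * q + 2 * l * w) ^ 2 := by gcongr
    have h7 := sq_nonneg (2 * n * s - l * q)
    have h8 := sq_nonneg (2 * n * s - 2 * l * w)
    have h9 := sq_nonneg (l * q - 2 * l * w)
    linarith
  have h6 : κ * b ^ 2 ≤ κ * (8 * (k * D)) := mul_le_mul_of_nonneg_left h4 (by linarith)
  have h7 : n * D ≤ k / 48 * D := mul_le_mul_of_nonneg_right (by linarith) hD0
  have h8 : k * D ≤ κ * k * D := mul_le_mul_of_nonneg_right hkκ hD0
  have h9 : κ * k * D ≤ R * D := mul_le_mul_of_nonneg_right hkR hD0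
  -- The `a²` part is at most `96nD + 6kD + 24RD ≤ 32RD`, and the `b²` part at most `8RD`. With `k ≤
  -- 48(n + ζ)` this gives `40 · 48 = 1920`.
  have h10 : a ^ 2 + κ * b ^ 2 ≤ 40 * (R * D) := by
    linarith
  refine h10.trans ?_
  have h11 : R ≤ κ / α * (48 * (n + ζ)) := by
    rw [hR, mul_div_right_comm]
    exact mul_le_mul_of_nonneg_left (by linarith) (by positivity)
  have h12 := mul_le_mul_of_nonneg_right h11 hD0
  calc 40 * (R * D) ≤ 40 * (κ / α * (48 * (n + ζ)) * D) := by linarith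
    _ = 1920 / α * κ * (n + ζ) * D := by ring

end SaddleAssumption

end Problem

end SmMGDA

/-! ### Telescoping -/

namespace SmMGDA

namespace Problem

variable {d₁ r d₂ : ℕ} {P : Problem d₁ r d₂} {ζ μ l : ℝ}

namespace SaddleAssumption

/-- The stationarity measure of one iteration is bounded by the decrease of the potential. -/
theorem step_stationarity (H : P.SaddleAssumption ζ μ l) {τ₁ τ₂ α β κ : ℝ} (hτ₁ : 0 < τ₁)
    (hτl : 3 * l ≤ 1 / τ₁) (hτ₂ : 0 < τ₂) (hk : 1 / τ₂ = 16 * (3 * (1 / τ₁) + ζ)) (hα : 0 < α)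
    (hα' : α < 1 / 2306) (hβ : β = α * min μ l * τ₂) (hκ : κ = max 1 (l / μ))
    {s : Iterate d₁ r d₂} (hx : s.x ∈ P.X) (hy : s.y ∈ P.Y) :
    ‖P.stepGx τ₁ (2 * l) s (P.step τ₁ τ₂ 0 (2 * l) β s)‖ ^ 2 +
        κ * ‖P.stepGy τ₂ s (P.step τ₁ τ₂ 0 (2 * l) β s)‖ ^ 2 ≤
      1920 / α * κ * (1 / τ₁ + ζ) * (P.potential (2 * l) s.x s.y s.z -
        P.potential (2 * l) (P.step τ₁ τ₂ 0 (2 * l) β s).x (P.step τ₁ τ₂ 0 (2 * l) β s).y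
          (P.step τ₁ τ₂ 0 (2 * l) β s).z) := by
  have hx' := H.step_x_mem τ₁ τ₂ 0 (2 * l) β s
  have hy' := H.step_y_mem hτ₂ τ₁ 0 (2 * l) β s
  have h := H.step_potential hτ₁ hτl hτ₂ hk hα hα' hβ hx hx' hy hy'
    (fun w hw => H.step_x_variational τ₁ τ₂ 0 (2 * l) β hx hy hw) (step_y_eq τ₁ τ₂ (2 * l) β s)
    (z' := (P.step τ₁ τ₂ 0 (2 * l) β s).z) rfl
  refine stationarity_arith (β := β) H.const.1 H.pl.mu_pos H.reg.zeta_nonneg hτl hk hα hα'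
    (by rw [hβ, one_div_one_div]) hκ (norm_nonneg _) (norm_nonneg _)
    (H.norm_stepGx_le hτ₁ hτl hx hy hx' hy') (H.norm_stepGy_le hτ₂ hy hx' hy') ?_
  linarith

/-- The convergence rate of smoothed MGDA. -/
theorem sum_stationarity_le (H : P.SaddleAssumption ζ μ l) {τ₁ τ₂ α β κ : ℝ} (hτ₁ : 0 < τ₁)
    (hτl : 3 * l ≤ 1 / τ₁) (hτ₂ : 0 < τ₂) (hk : 1 / τ₂ = 16 * (3 * (1 / τ₁) + ζ)) (hα : 0 < α)
    (hα' : α < 1 / 2306) (hβ : β = α * min μ l * τ₂) (hκ : κ = max 1 (l / μ))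
    {s : ℕ → Iterate d₁ r d₂} (hx : ∀ t, (s t).x ∈ P.X) (hy : ∀ t, (s t).y ∈ P.Y)
    (hstep : ∀ t, s (t + 1) = P.step τ₁ τ₂ 0 (2 * l) β (s t)) (T : ℕ) :
    ∑ t ∈ Finset.range T, (‖P.stepGx τ₁ (2 * l) (s t) (s (t + 1))‖ ^ 2 +
        κ * ‖P.stepGy τ₂ (s t) (s (t + 1))‖ ^ 2) ≤
      1920 / α * κ * (1 / τ₁ + ζ) *
        (P.Pval (2 * l) (s 0).z - P.Fbar + P.Delta (2 * l) (s 0).x (s 0).y (s 0).z) := by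
  set V : ℕ → ℝ := fun t => P.potential (2 * l) (s t).x (s t).y (s t).z with hV
  set M := 1920 / α * κ * (1 / τ₁ + ζ) with hM
  have hM0 : 0 ≤ M := by
    have : 0 ≤ κ := by rw [hκ]; exact zero_le_one.trans (le_max_left _ _)
    have := H.reg.zeta_nonneg
    positivity
  calc ∑ t ∈ Finset.range T, (‖P.stepGx τ₁ (2 * l) (s t) (s (t + 1))‖ ^ 2 +
        κ * ‖P.stepGy τ₂ (s t) (s (t + 1))‖ ^ 2)
      ≤ ∑ t ∈ Finset.range T, M * (V t - V (t + 1)) := by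
        refine Finset.sum_le_sum fun t _ => ?_
        simp only [hV, hstep t]
        exact H.step_stationarity hτ₁ hτl hτ₂ hk hα hα' hβ hκ (hx t) (hy t)
    _ = M * (V 0 - V T) := by rw [← Finset.mul_sum, Finset.sum_range_sub']
    _ ≤ _ := by
        refine mul_le_mul_of_nonneg_left ?_ hM0
        have := H.Fbar_le_potential (hx T) (hy T) (s T).z
        simp only [hV, potential, Delta] at this ⊢
        linarith

end SaddleAssumption

end Problem

end SmMGDA

/-! ### Assembly of the rate, the inclusions and the best iterate -/

theorem mainTheorem3 :
    ∃ K : ℝ, 0 < K ∧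
      ∀ (d₁ r d₂ : ℕ) (P : SmMGDA.Problem d₁ r d₂) (ζ μ : ℝ),
        0 < P.C → 0 < P.ρ →
        P.RegularizerAssumption ζ → P.SmoothnessAssumption → P.PLAssumption μ →
        (∃ l : ℝ, P.IsSmoothnessConst l) ∧
        ∀ l : ℝ, P.IsSmoothnessConst l →
        ∀ (τ₁ τ₂ p α β κbar : ℝ),
          0 < τ₁ → τ₁ ≤ 1 / (3 * l) →
          τ₂ = 1 / 16 * (3 / τ₁ + ζ)⁻¹ →
          p = 2 * l →
          0 < α → α < 1 / 2306 →
          β = α * min μ l * τ₂ →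
          κbar = max 1 (l / μ) →
        ∀ (s : ℕ → SmMGDA.Problem.Iterate d₁ r d₂),
          (s 0).x ∈ P.X → (s 0).y ∈ P.Y →
          s = P.smMGDA (fun _ => τ₁) (fun _ => 0) τ₂ p β (s 0) →
        ∀ (Gx : ℕ → SmMGDA.XSpace d₁ r) (Gy : ℕ → SmMGDA.YSpace d₂) (Δ₀ : ℝ),
          (∀ t, Gx (t + 1) = P.stepGx τ₁ p (s t) (s (t + 1))) →
          (∀ t, Gy (t + 1) = P.stepGy τ₂ (s t) (s (t + 1))) →
          Δ₀ = P.Delta p (s 0).x (s 0).y (s 0).z →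
          -- the rate
          (∀ T : ℕ, 1 ≤ T →
            1 / (T : ℝ) * ∑ t ∈ Finset.Icc 1 T, (‖Gx t‖ ^ 2 + κbar * ‖Gy t‖ ^ 2) ≤
              K / α * κbar / T * (1 / τ₁ + ζ) * (P.Pval p (s 0).z - P.Fbar + Δ₀)) ∧
          -- the subgradient inclusions
          (∀ t : ℕ, 1 ≤ t →
            Gx t ∈ P.xSubdiff (s t).x (s t).y ∧
            Gy t ∈ (fun g => P.ftGradY (s t).x (s t).y - g) ''
              SmMGDA.frechetSubdiff P.h (s t).y) ∧
          -- approximate stationarity of the best iterate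
          (∀ T : ℕ, 1 ≤ T → ∀ ε : ℝ,
            ε = √(K / α * κbar / T * (1 / τ₁ + ζ) * (P.Pval p (s 0).z - P.Fbar + Δ₀)) →
            ∃ t ∈ Finset.Icc 1 T,
              max (Metric.infEDist 0 (P.xSubdiff (s t).x (s t).y))
                (ENNReal.ofReal √κbar * Metric.infEDist 0 (P.ySubdiff (s t).x (s t).y)) ≤
                  ENNReal.ofReal ε ∧
              P.IsApproxStationary ε (s t).x (s t).y) ∧
          -- the initial gap
          0 ≤ Δ₀ ∧ Δ₀ ≤ 2 * P.gap p (s 0).x (s 0).y (s 0).z := by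
  refine ⟨1920, by norm_num, ?_⟩
  intro d₁ r d₂ P ζ μ hC hρ hreg hsm hpl
  refine ⟨SmMGDA.Problem.exists_isSmoothnessConst hreg hsm, ?_⟩
  intro l hl τ₁ τ₂ p α β κbar hτ₁ hτl hτ₂ hp hα hα' hβ hκ s hx₀ hy₀ hs Gx Gy Δ₀ hGx hGy hΔ
  subst hp
  have H : P.SaddleAssumption ζ μ l := ⟨hC, hρ, hreg, hsm, hpl, hl⟩
  have hl0 := hl.1
  have hζ := hreg.zeta_nonneg
  have hτl' : 3 * l ≤ 1 / τ₁ := by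
    rw [le_one_div (by positivity) hτ₁]; exact hτl
  have hτ₂0 : 0 < τ₂ := by rw [hτ₂]; positivity
  have hk : 1 / τ₂ = 16 * (3 * (1 / τ₁) + ζ) := by
    rw [hτ₂, mul_one_div, one_div, mul_inv, inv_inv]; norm_num
  have hκ1 : 1 ≤ κbar := by rw [hκ]; exact le_max_left _ _
  have hκ0 : 0 ≤ κbar := zero_le_one.trans hκ1
  have hstep : ∀ t, s (t + 1) = P.step τ₁ τ₂ 0 (2 * l) β (s t) := by
    intro t
    conv_lhs => rw [hs]
    conv_rhs => rw [hs]
    rfl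
  have hx : ∀ t, (s t).x ∈ P.X := by
    rintro (_ | t)
    · exact hx₀
    · rw [hstep]; exact H.step_x_mem _ _ _ _ _ _
  have hy : ∀ t, (s t).y ∈ P.Y := by
    rintro (_ | t)
    · exact hy₀
    · rw [hstep]; exact H.step_y_mem hτ₂0 _ _ _ _ _
  have hincl : ∀ t : ℕ, 1 ≤ t →
      Gx t ∈ P.xSubdiff (s t).x (s t).y ∧
      Gy t ∈ (fun g => P.ftGradY (s t).x (s t).y - g) ''
        SmMGDA.frechetSubdiff P.h (s t).y := by
    rintro (_ | t) ht
    · omega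
    · rw [hGx, hGy, hstep]
      exact ⟨H.stepGx_mem_xSubdiff hτ₁ _ _ _ _ (hx t) (hy t), H.stepGy_mem hτ₂0 _ _ _ _⟩
  have hrate : ∀ T : ℕ, 1 ≤ T →
      1 / (T : ℝ) * ∑ t ∈ Finset.Icc 1 T, (‖Gx t‖ ^ 2 + κbar * ‖Gy t‖ ^ 2) ≤
        1920 / α * κbar / T * (1 / τ₁ + ζ) * (P.Pval (2 * l) (s 0).z - P.Fbar + Δ₀) := by
    intro T hT
    have hT0 : (0 : ℝ) < T := by exact_mod_cast hT
    have hsum := H.sum_stationarity_le hτ₁ hτl' hτ₂0 hk hα hα' hβ hκ hx hy hstep T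
    rw [← hΔ] at hsum
    simp only [← hGx, ← hGy] at hsum
    have hIcc : ∑ t ∈ Finset.Icc 1 T, (‖Gx t‖ ^ 2 + κbar * ‖Gy t‖ ^ 2) =
        ∑ t ∈ Finset.range T, (‖Gx (t + 1)‖ ^ 2 + κbar * ‖Gy (t + 1)‖ ^ 2) := by
      rw [Finset.range_eq_Ico, Finset.sum_Ico_add' (fun t => ‖Gx t‖ ^ 2 + κbar * ‖Gy t‖ ^ 2) 0 T 1]
      rfl
    rw [hIcc]
    calc _ ≤ 1 / (T : ℝ) * (1920 / α * κbar * (1 / τ₁ + ζ) *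
          (P.Pval (2 * l) (s 0).z - P.Fbar + Δ₀)) :=
        mul_le_mul_of_nonneg_left hsum (by positivity)
      _ = _ := by ring
  refine ⟨hrate, hincl, ?_, ?_, ?_⟩
  · intro T hT ε hε
    have hT0 : (0 : ℝ) < T := by exact_mod_cast hT
    set B := 1920 / α * κbar / T * (1 / τ₁ + ζ) * (P.Pval (2 * l) (s 0).z - P.Fbar + Δ₀)
    -- Some term is at most the average, so a single index serves both residuals.
    obtain ⟨t, ht, hle⟩ : ∃ t ∈ Finset.Icc 1 T, ‖Gx t‖ ^ 2 + κbar * ‖Gy t‖ ^ 2 ≤ B := by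
      refine Finset.exists_le_of_sum_le ⟨1, Finset.mem_Icc.2 ⟨le_rfl, hT⟩⟩ ?_
      have := hrate T hT
      rw [one_div, inv_mul_le_iff₀ hT0] at this
      rwa [Finset.sum_const, Nat.card_Icc, add_tsub_cancel_right, nsmul_eq_mul]
    obtain ⟨hGxt, g, hg, hGyt⟩ := hincl t (Finset.mem_Icc.1 ht).1
    have hdx : Metric.infEDist 0 (P.xSubdiff (s t).x (s t).y) ≤ ENNReal.ofReal ‖Gx t‖ := by
      refine (Metric.infEDist_le_edist_of_mem hGxt).trans_eq ?_
      rw [edist_comm, edist_zero_right, ofReal_norm]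
    -- The element `-∇_y f̃ + g` of `ySubdiff` is `-G^y`, of the same norm.
    have hdy : Metric.infEDist 0 (P.ySubdiff (s t).x (s t).y) ≤ ENNReal.ofReal ‖Gy t‖ := by
      refine (Metric.infEDist_le_edist_of_mem (Set.mem_image_of_mem _ hg)).trans_eq ?_
      rw [edist_comm, edist_zero_right, ← hGyt, ofReal_norm, neg_add_eq_sub, ← enorm_neg, neg_sub]
    have hxε : ‖Gx t‖ ≤ ε := by
      rw [hε]
      refine Real.le_sqrt_of_sq_le ?_
      have : 0 ≤ κbar * ‖Gy t‖ ^ 2 := by positivity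
      linarith
    have hyε : √κbar * ‖Gy t‖ ≤ ε := by
      rw [hε]
      refine Real.le_sqrt_of_sq_le ?_
      rw [mul_pow, Real.sq_sqrt hκ0]
      have : 0 ≤ ‖Gx t‖ ^ 2 := by positivity
      linarith
    have hyε' : ‖Gy t‖ ≤ ε :=
      (le_mul_of_one_le_left (norm_nonneg _) (Real.one_le_sqrt.2 hκ1)).trans hyε
    refine ⟨t, ht, max_le (hdx.trans (ENNReal.ofReal_le_ofReal hxε)) ?_, hx t, hy t,
      hdx.trans (ENNReal.ofReal_le_ofReal hxε), hdy.trans (ENNReal.ofReal_le_ofReal hyε')⟩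
    refine (mul_le_mul_right hdy _).trans ?_
    rw [← ENNReal.ofReal_mul (Real.sqrt_nonneg _)]
    exact ENNReal.ofReal_le_ofReal hyε
  · rw [hΔ]; exact H.Delta_nonneg hx₀ hy₀ _
  · rw [hΔ]; exact H.Delta_le_two_mul_gap hx₀ hy₀ _
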